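/- For integers $m\ge 3$ and $k\ge 0$ let $F(m,k)$ be the $m$-barrel fullerene graph with $k$ layers of hexagons, drawn on a cylinder: its $m(k+2)$ horizontal edges $e_{j,l}$, $0\le j\le k+1$, $l\in I_m=\{0,\dots,m-1\}$ (with $l$ read modulo $m$) cover every vertex exactly once; for $0\le j\le k$ the right endpoints of the edges $e_{j,l}$ and the left endpoints of the edges $e_{j+1,l}$ form a cycle of length $2m$, in which the left endpoint of $e_{j+1,l}$ is adjacent to the right endpoints of $e_{j,l}$ and $e_{j,l+1}$; the left endpoints of $e_{0,0},\dots,e_{0,m-1}$, and likewise the right endpoints of $e_{k+1,0},\dots,e_{k+1,m-1}$, form an $m$-gon in this cyclic order. The edges $e_{j,0},\dots,e_{j,m-1}$ form the slice $E_j$. Let $\Phi(G)$ be the number of perfect matchings of a graph $G$. Let $A=(a_{S,T})_{S,T\subset I_m}$ be the transfer matrix: $a_{S,T}$ is the number of perfect matchings of the cycle of length $2m$ between two consecutive slices after removal of the vertices attached to the edges with index in $S$ of the left slice and with index in $T$ of the right slice. The sector $p$ ($0\le p\le m$) is the block of $A$ indexed by the subsets with $p$ elements. The largest eigenvalue of a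 real square matrix is understood in the Perron--Frobenius sense: a real eigenvalue that is at least the modulus of every complex eigenvalue. **Theorem.** Fix $m\ge 3$ and let $p_0=m-2\lfloor\frac{m+1}{3}\rfloor$. 1. For every $0\le p\le m$, the largest eigenvalue of $A$ in the sector $p$ is $$\lambda_{\max}^{(p)}=\begin{cases}\dfrac{2}{\prod_{r=0}^{q-1}4\sin^2\left(\pi\frac{2r+1}{2m}\right)} & \text{if } p=2q,\\[3ex] \dfrac{m}{\prod_{r=1}^{q}4\sin^2\left(\frac{\pi r}{m}\right)} & \text{if } p=2q+1.\end{cases}$$ 2. The growth constant $\rho(m)=\lim_{k\to\infty}\Phi(F(m,k))^{1/k}$ exists and $\rho(m)=\lambda_{\max}^{(p_0)}$. 3. For a uniformly random perfect matching of $F(m,k)$, the number of horizontal edges in every slice converges in probability to $p_0$ as $k\to\infty$, uniformly in the slice: for every $\varepsilon>0$, the probability that some slice $E_j$, $0\le j\le k+1$, contains a number $N_j$ of matching edges with $|N_j-p_0|\ge\varepsilon$ tends to $0$. 4. The contribution of the other sectors is exponentially smaller: there are constants $C>0$ and $r\in(0,1)$, depending only on $m$, such that for every $k\ge0$ the number of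 perfect matchings of $F(m,k)$ that have a slice containing a number of matching edges different from $p_0$ is at most $C\,r^k\,(\lambda_{\max}^{(p_0)})^k$. -/

import Mathlib

open Filter Topology

/-- Vertices of the `m`-barrel fullerene `F(m,k)`, drawn on a cylinder whose axis is horizontal.
Every vertex is an endpoint of exactly one horizontal edge `e_{j,l}`, where `j = 0, …, k+1`
is the slice and `l` (cyclic, modulo `m`) is the height.
`(j, l, false)` is the left endpoint of `e_{j,l}` and `(j, l, true)` is its right endpoint. -/
abbrev BarrelVertex (m k : ℕ) : Type := Fin (k + 2) × Fin m × Bool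

/-- The edges of `F(m,k)`; `finRotate m l` is `l + 1` modulo `m`.
* `horizontal`: the edge `e_{j,l}`.
* `below`, `above`: the `k + 1` cycles of length `2m`, separating slice `j` from slice `j + 1`.
  The left endpoint of `e_{j+1,l}` lies on that cycle between the right endpoints of `e_{j,l}`
  (just below) and of `e_{j,l+1}` (just above).
* `leftGon`, `rightGon`: the two `m`-gons at the ends of the cylinder. -/
inductive BarrelEdge (m k : ℕ) : BarrelVertex m k → BarrelVertex m k → Prop
  | horizontal (j : Fin (k + 2)) (l : Fin m) : BarrelEdge m k (j, l, false) (j, l, true)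
  | below (j : Fin (k + 1)) (l : Fin m) :
      BarrelEdge m k (j.castSucc, l, true) (j.succ, l, false)
  | above (j : Fin (k + 1)) (l : Fin m) :
      BarrelEdge m k (j.castSucc, finRotate m l, true) (j.succ, l, false)
  | leftGon (l : Fin m) : BarrelEdge m k (0, l, false) (0, finRotate m l, false)
  | rightGon (l : Fin m) :
      BarrelEdge m k (Fin.last (k + 1), l, true) (Fin.last (k + 1), finRotate m l, true)

/-- The `m`-barrel fullerene `F(m,k)` (for `m ≥ 3`), with `k` layers of hexagons. -/
def barrelFullerene (m k : ℕ) : SimpleGraph (BarrelVertex m k) :=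
  SimpleGraph.fromRel (BarrelEdge m k)

/-- The perfect matchings of a graph. -/
abbrev PerfectMatching {V : Type*} (G : SimpleGraph V) : Type _ :=
  {M : G.Subgraph // M.IsPerfectMatching}

/-- `Φ(G)`, the number of perfect matchings of `G`. -/
noncomputable def numPerfectMatchings {V : Type*} (G : SimpleGraph V) : ℕ :=
  Nat.card (PerfectMatching G)

/-- The number of horizontal edges (horizontal rhombi) of a perfect matching in slice `j`. -/
noncomputable def horizontalCount {m k : ℕ} (M : PerfectMatching (barrelFullerene m k))
    (j : Fin (k + 2)) : ℕ :=
  Nat.card {l : Fin m // M.1.Adj (j, l, false) (j, l, true)}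

/-- Probability of an event for a uniformly random perfect matching of `F(m,k)`. -/
noncomputable def matchingProb (m k : ℕ) (E : Set (PerfectMatching (barrelFullerene m k))) : ℝ :=
  (Nat.card E : ℝ) / (numPerfectMatchings (barrelFullerene m k) : ℝ)

/-- The cycle of length `2m` between two consecutive slices: `Sum.inl l` is attached to the
`l`-th horizontal edge on the left and `Sum.inr l` to the `l`-th horizontal edge on the right. -/
def layerCycle (m : ℕ) : SimpleGraph (Fin m ⊕ Fin m) :=
  SimpleGraph.fromRel fun u v =>
    ∃ l : Fin m, v = Sum.inr l ∧ (u = Sum.inl l ∨ u = Sum.inl (finRotate m l))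

/-- The vertices of the cycle that remain after removing those attached to the horizontal edges
in `S` (on the left) and in `T` (on the right). -/
def layerRemaining (m : ℕ) (S T : Finset (Fin m)) : Set (Fin m ⊕ Fin m) :=
  {v | (∀ l ∈ S, v ≠ Sum.inl l) ∧ (∀ l ∈ T, v ≠ Sum.inr l)}

/-- The transfer matrix `A`, indexed by the subsets of `{0, …, m-1}`: its entry `a_{S,T}` is the
number of perfect matchings of the cycle after the removal of the vertices given by `S`, `T`. -/
noncomputable def transferMatrix (m : ℕ) : Matrix (Finset (Fin m)) (Finset (Fin m)) ℝ :=
  Matrix.of fun S T =>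
    (numPerfectMatchings ((layerCycle m).induce (layerRemaining m S T)) : ℝ)

/-- Sector `p`: the block of the transfer matrix indexed by the subsets with `p` elements. -/
noncomputable def sectorBlock (m p : ℕ) :
    Matrix {S : Finset (Fin m) // S.card = p} {S : Finset (Fin m) // S.card = p} ℝ :=
  (transferMatrix m).submatrix Subtype.val Subtype.val

/-- `x` is the largest eigenvalue of the real square matrix `M`, in the Perron–Frobenius sense:
it is a real eigenvalue, and no complex eigenvalue has larger modulus. -/
def IsLargestEigenvalue {n : Type*} [Fintype n] [DecidableEq n] (M : Matrix n n ℝ) (x : ℝ) :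
    Prop :=
  Module.End.HasEigenvalue (Matrix.toLin' M) x ∧
    ∀ μ : ℂ, Module.End.HasEigenvalue (Matrix.toLin' (M.map (fun a : ℝ => (a : ℂ)))) μ → ‖μ‖ ≤ x

/-- The explicit value `λ_max^{(p)}`, with `p / 2 = q` for `p = 2q` and for `p = 2q + 1`. -/
noncomputable def lamMax (m p : ℕ) : ℝ :=
  if Even p then
    2 / ∏ r ∈ Finset.range (p / 2), (4 * Real.sin (Real.pi * (2 * (r : ℝ) + 1) / (2 * (m : ℝ))) ^ 2)
  else
    (m : ℝ) / ∏ r ∈ Finset.Icc 1 (p / 2), (4 * Real.sin (Real.pi * (r : ℝ) / (m : ℝ)) ^ 2)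

/-- The dominant sector `p₀ = m - 2⌊(m+1)/3⌋` (a true subtraction as soon as `m ≥ 2`). -/
def dominantSector (m : ℕ) : ℕ := m - 2 * ((m + 1) / 3)

/-!
A perfect matching is determined by its horizontal edges together with independent matchings of the
two end polygons and of the `k + 1` cycles. A cycle can only be matched if equally many vertices are
removed on its two sides, so the number `p` of horizontal edges is the same in all slices, and the
number of matchings with a given `p` is `⟨b, A ^ (k + 1) b⟩`, where `b` counts the matchings of the
end polygon.

Seen from the complement, `A` moves `n = m - p` particles on the cycle `ℤ/m`: each of them stays or
hops one step, and no two may collide. These are free fermions. For particles at angles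
`x₁ < ⋯ < xₙ`, the product of `2 sin (xⱼ - xᵢ)` over `i < j` is a Vandermonde determinant, hence
additive in each row, and it vanishes whenever two particles collide, so it is an eigenvector of
`A`. It is positive, hence a Perron vector, and its eigenvalue is
`∏ 2 cos (π a / (2 m))` over `a = -(n-1), -(n-3), …, n-1`. Passing from `n` to `n + 2` multiplies
this by `4 cos² (π (n + 1) / (2 m))`, which exceeds `1` exactly when the angle is less than `π / 3`.
The eigenvalue is therefore unimodal in even `n`, with its strict maximum at `n = 2⌊(m+1)/3⌋`.

`A` is not symmetric, but it is so up to the rotation of the cycle, which fixes both `b` and the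
Perron vector `v`. Thus `⟨b, A ^ (2 i) b⟩ = ‖A ^ i b‖²`, and by Cauchy–Schwarz this is at least
`λ ^ (2 i) ⟨v, b⟩² / ‖v‖²`. The upper bound is the comparison of `b` with a multiple of `v`.
-/

/-! ### Perfect matchings as exact covers -/

/-- Exactly one of three propositions holds: the condition that a vertex of degree three is covered
exactly once. -/
def ExactlyOne (a b c : Prop) : Prop :=
  (a ∧ ¬b ∧ ¬c) ∨ (¬a ∧ b ∧ ¬c) ∨ (¬a ∧ ¬b ∧ c)

theorem exactlyOne_right_comm {a b c : Prop} : ExactlyOne a b c ↔ ExactlyOne a c b := by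
  unfold ExactlyOne
  tauto

theorem existsUnique_mem_iff_exactlyOne {E : Type*} {X : Set E} {I : E → Prop} {a b c : E}
    (hab : a ≠ b) (hac : a ≠ c) (hbc : b ≠ c) (hI : ∀ e, I e ↔ e = a ∨ e = b ∨ e = c) :
    (∃! e, e ∈ X ∧ I e) ↔ ExactlyOne (a ∈ X) (b ∈ X) (c ∈ X) := by
  simp only [hI, ExistsUnique, ExactlyOne]
  grind

theorem existsUnique_mem_iff_exactlyOne_of_pair {E : Type*} {X : Set E} {I : E → Prop} {p : Prop}
    {b c : E} (hbc : b ≠ c) (hI : ∀ e, I e ↔ e = b ∨ e = c) :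
    ((¬p → ∃! e, e ∈ X ∧ I e) ∧ ∀ e ∈ X, I e → ¬p) ↔ ExactlyOne p (b ∈ X) (c ∈ X) := by
  simp only [hI, ExistsUnique, ExactlyOne]
  grind

theorem card_add_ncard_of_exactlyOne {α : Type*} [Fintype α] {S : Finset α} {D U : Set α}
    (h : ∀ l, ExactlyOne (l ∈ S) (l ∈ D) (l ∈ U)) :
    S.card + D.ncard + U.ncard = Fintype.card α := by
  unfold ExactlyOne at h
  have hSD : Disjoint (S : Set α) D := Set.disjoint_left.2 fun l => by
    have := h l
    rw [Finset.mem_coe]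
    tauto
  have hU : Disjoint ((S : Set α) ∪ D) U := Set.disjoint_left.2 fun l => by
    have := h l
    rw [Set.mem_union, Finset.mem_coe]
    tauto
  have huniv : (S : Set α) ∪ D ∪ U = Set.univ := Set.eq_univ_of_forall fun l => by
    have := h l
    rw [Set.mem_union, Set.mem_union, Finset.mem_coe]
    tauto
  rw [← Set.ncard_coe_finset, ← Set.ncard_union_eq hSD, ← Set.ncard_union_eq hU, huniv,
    Set.ncard_univ, Nat.card_eq_fintype_card]

/-- A labelling by `E` of the edges of `G`, whose vertices are embedded in a type `W`. Since `W` may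
be larger than the vertex set, the induced subgraphs of a graph share its labels; a label with an
endpoint outside the range of `emb` is not an edge of `G`. -/
structure EdgeLabelling {V : Type*} (G : SimpleGraph V) (W E : Type*) where
  emb : V ↪ W
  ends : E → Sym2 W
  ends_injective : Function.Injective ends
  adj_iff : ∀ x y, G.Adj x y ↔ ∃ e, ends e = s(emb x, emb y)

namespace EdgeLabelling

variable {V W E : Type*} {G : SimpleGraph V} (L : EdgeLabelling G W E)

/-- A set of labels such that every vertex of the graph is an endpoint of exactly one of them, and
no other vertex is an endpoint. -/
def IsExactCover (X : Set E) : Prop :=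
  (∀ x, ∃! e, e ∈ X ∧ L.emb x ∈ L.ends e) ∧ ∀ e ∈ X, ∀ v ∈ L.ends e, v ∈ Set.range L.emb

/-- The labels of the edges of a perfect matching. -/
def labelSet (M : PerfectMatching G) : Set E :=
  {e | ∃ x y, M.1.Adj x y ∧ L.ends e = s(L.emb x, L.emb y)}

theorem mem_labelSet_iff {M : PerfectMatching G} {e : E} {x y : V}
    (he : L.ends e = s(L.emb x, L.emb y)) : e ∈ L.labelSet M ↔ M.1.Adj x y := by
  refine ⟨fun ⟨a, b, hab, h⟩ => ?_, fun h => ⟨x, y, h, he⟩⟩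
  rw [he, Sym2.eq_iff] at h
  rcases h with ⟨hxa, hyb⟩ | ⟨hxb, hya⟩
  · rwa [L.emb.injective hxa, L.emb.injective hyb]
  · rw [L.emb.injective hxb, L.emb.injective hya]
    exact hab.symm

theorem isExactCover_labelSet (M : PerfectMatching G) : L.IsExactCover (L.labelSet M) := by
  constructor
  · intro x
    obtain ⟨y, hxy, hunique⟩ := M.2.1 (M.2.2 x)
    obtain ⟨e, he⟩ := (L.adj_iff x y).1 hxy.adj_sub
    refine ⟨e, ⟨⟨x, y, hxy, he⟩, by simp [he]⟩, ?_⟩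
    rintro e' ⟨⟨a, b, hab, he'⟩, hx⟩
    apply L.ends_injective
    rw [he', Sym2.mem_iff] at hx
    rcases hx with hxa | hxb
    · obtain rfl := L.emb.injective hxa
      rw [he, he', hunique b hab]
    · obtain rfl := L.emb.injective hxb
      rw [he, he', hunique a hab.symm, Sym2.eq_swap]
  · rintro e ⟨x, y, -, he⟩ v hv
    rw [he, Sym2.mem_iff] at hv
    rcases hv with rfl | rfl <;> exact ⟨_, rfl⟩

theorem labelSet_injective : Function.Injective L.labelSet := by
  intro M N h
  refine Subtype.ext (SimpleGraph.Subgraph.ext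
    ((Set.eq_univ_of_forall M.2.2).trans (Set.eq_univ_of_forall N.2.2).symm) ?_)
  ext x y
  by_cases hxy : G.Adj x y
  · obtain ⟨e, he⟩ := (L.adj_iff x y).1 hxy
    rw [← L.mem_labelSet_iff he, ← L.mem_labelSet_iff he, h]
  · exact iff_of_false (fun hM => hxy hM.adj_sub) (fun hN => hxy hN.adj_sub)

/-- The perfect matching whose edges have the labels of an exact cover. -/
def ofExactCover {X : Set E} (hX : L.IsExactCover X) : PerfectMatching G :=
  ⟨{  verts := Set.univ
      Adj := fun x y => ∃ e ∈ X, L.ends e = s(L.emb x, L.emb y)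
      adj_sub := fun {x y} ⟨e, _, he⟩ => (L.adj_iff x y).2 ⟨e, he⟩
      edge_vert := fun _ => Set.mem_univ _
      symm := ⟨fun _ _ ⟨e, heX, he⟩ => ⟨e, heX, he.trans Sym2.eq_swap⟩⟩ }, by
    refine ⟨fun x _ => ?_, fun x => Set.mem_univ x⟩
    obtain ⟨e, ⟨heX, hxe⟩, hunique⟩ := hX.1 x
    obtain ⟨v, hv⟩ := Sym2.mem_iff_exists.1 hxe
    obtain ⟨y, rfl⟩ := hX.2 e heX v (by simp [hv])
    refine ⟨y, ⟨e, heX, hv⟩, ?_⟩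
    rintro y' ⟨e', he', h⟩
    obtain rfl := hunique e' ⟨he', by simp [h]⟩
    exact L.emb.injective (Sym2.congr_right.1 (h.symm.trans hv))⟩

theorem labelSet_ofExactCover {X : Set E} (hX : L.IsExactCover X) :
    L.labelSet (L.ofExactCover hX) = X := by
  ext e
  constructor
  · rintro ⟨x, y, ⟨e', he'X, he'⟩, he⟩
    rwa [L.ends_injective (he.trans he'.symm)]
  · intro heX
    obtain ⟨v, w, hvw⟩ : ∃ v w, L.ends e = s(v, w) := by
      induction h : L.ends e with | _ v w => exact ⟨v, w, rfl⟩
    obtain ⟨x, rfl⟩ := hX.2 e heX v (by simp [hvw])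
    obtain ⟨y, rfl⟩ := hX.2 e heX w (by simp [hvw])
    exact ⟨x, y, ⟨e, heX, hvw⟩, hvw⟩

/-- Perfect matchings correspond to exact covers by labels. -/
noncomputable def perfectMatchingEquiv : PerfectMatching G ≃ {X : Set E // L.IsExactCover X} :=
  Equiv.ofBijective (fun M => ⟨L.labelSet M, L.isExactCover_labelSet M⟩)
    ⟨fun _ _ h => L.labelSet_injective (congrArg Subtype.val h),
      fun X => ⟨L.ofExactCover X.2, Subtype.ext (L.labelSet_ofExactCover X.2)⟩⟩

end EdgeLabelling

/-! ### Matchings of a layer and of an end polygon -/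

theorem val_finRotate {m : ℕ} (l : Fin m) :
    (finRotate m l : ℕ) = if (l : ℕ) + 1 = m then 0 else (l : ℕ) + 1 := by
  obtain _ | n := m
  · exact l.elim0
  · rw [coe_finRotate]
    simp [Fin.ext_iff]

theorem finRotate_ne_self {m : ℕ} (hm : 2 ≤ m) (l : Fin m) : finRotate m l ≠ l := by
  refine Fin.ne_of_val_ne ?_
  rw [val_finRotate]
  split_ifs <;> omega

/-- The pairs `(D, U)` encoding a perfect matching of the cycle between two slices, after removal
of `S` on the left and `T` on the right: `D` contains the heights `l` of the edges from `inl l` to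
`inr l`, and `U` the heights `l` of the edges from `inl (l + 1)` to `inr l`. -/
def IsLayerMatching {m : ℕ} (S T : Finset (Fin m)) (D U : Set (Fin m)) : Prop :=
  (∀ l, ExactlyOne (l ∈ S) (l ∈ D) ((finRotate m).symm l ∈ U)) ∧
    ∀ l, ExactlyOne (l ∈ T) (l ∈ D) (l ∈ U)

/-- The perfect matchings of the cycle between two slices, after removal of `S` and `T`. -/
abbrev LayerMatching {m : ℕ} (S T : Finset (Fin m)) : Type :=
  {DU : Set (Fin m) × Set (Fin m) // IsLayerMatching S T DU.1 DU.2}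

/-- The sets encoding a perfect matching of the `m`-gon after removal of `S`: `L` contains `l` for
each edge from `l` to `l + 1`. -/
def IsGonMatching {m : ℕ} (S : Finset (Fin m)) (L : Set (Fin m)) : Prop :=
  ∀ l, ExactlyOne (l ∈ S) (l ∈ L) ((finRotate m).symm l ∈ L)

/-- The perfect matchings of the `m`-gon after removal of `S`. -/
abbrev GonMatching {m : ℕ} (S : Finset (Fin m)) : Type :=
  {L : Set (Fin m) // IsGonMatching S L}

/-- The endpoints of the edges of the layer cycle: `inl l` labels the edge between the left and
right vertices at height `l`, and `inr l` the other edge at the right vertex. -/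
def layerEnds (m : ℕ) : Fin m ⊕ Fin m → Sym2 (Fin m ⊕ Fin m)
  | Sum.inl l => s(Sum.inl l, Sum.inr l)
  | Sum.inr l => s(Sum.inl (finRotate m l), Sum.inr l)

theorem layerEnds_injective {m : ℕ} (hm : 2 ≤ m) : Function.Injective (layerEnds m) := by
  rintro (a | a) (b | b) h <;>
    simp only [layerEnds, Sym2.eq_iff, Sum.inl.injEq, Sum.inr.injEq, reduceCtorEq, false_and,
      or_false] at h
  · rw [h.1]
  · exact absurd (h.1.symm.trans h.2) (finRotate_ne_self hm b)
  · exact absurd (h.1.trans h.2.symm) (finRotate_ne_self hm a)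
  · rw [h.2]

theorem layerCycle_adj_iff (m : ℕ) (x y : Fin m ⊕ Fin m) :
    (layerCycle m).Adj x y ↔ ∃ e, layerEnds m e = s(x, y) := by
  rw [layerCycle, SimpleGraph.fromRel_adj]
  constructor
  · rintro ⟨-, ⟨l, rfl, rfl | rfl⟩ | ⟨l, rfl, rfl | rfl⟩⟩
    · exact ⟨Sum.inl l, rfl⟩
    · exact ⟨Sum.inr l, rfl⟩
    · exact ⟨Sum.inl l, Sym2.eq_swap⟩
    · exact ⟨Sum.inr l, Sym2.eq_swap⟩
  · rintro ⟨e | e, h⟩ <;> rw [layerEnds, Sym2.eq_iff] at h <;>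
      rcases h with ⟨rfl, rfl⟩ | ⟨rfl, rfl⟩ <;> simp

theorem inl_mem_layerEnds_iff {m : ℕ} (l : Fin m) (e : Fin m ⊕ Fin m) :
    Sum.inl l ∈ layerEnds m e ↔ e = Sum.inl l ∨ e = Sum.inr ((finRotate m).symm l) := by
  rcases e with e | e <;>
    simp [layerEnds, eq_comm, Equiv.eq_symm_apply, -finRotate_apply, -finRotate_symm_apply]

theorem inr_mem_layerEnds_iff {m : ℕ} (l : Fin m) (e : Fin m ⊕ Fin m) :
    Sum.inr l ∈ layerEnds m e ↔ e = Sum.inl l ∨ e = Sum.inr l := by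
  rcases e with e | e <;> simp [layerEnds, eq_comm]

/-- The edges of the cycle between two slices, as labels for what remains of it. -/
def layerLabelling {m : ℕ} (hm : 2 ≤ m) (S T : Finset (Fin m)) :
    EdgeLabelling ((layerCycle m).induce (layerRemaining m S T)) (Fin m ⊕ Fin m)
      (Fin m ⊕ Fin m) where
  emb := Function.Embedding.subtype _
  ends := layerEnds m
  ends_injective := layerEnds_injective hm
  adj_iff x y := layerCycle_adj_iff m x.1 y.1

theorem isExactCover_layerLabelling_iff {m : ℕ} (hm : 2 ≤ m) (S T : Finset (Fin m))
    (X : Set (Fin m ⊕ Fin m)) :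
    (layerLabelling hm S T).IsExactCover X ↔
      IsLayerMatching S T (Sum.inl ⁻¹' X) (Sum.inr ⁻¹' X) := by
  have cover_iff : (layerLabelling hm S T).IsExactCover X ↔
      ∀ v, (¬v ∉ layerRemaining m S T → ∃! e, e ∈ X ∧ v ∈ layerEnds m e) ∧
        ∀ e ∈ X, v ∈ layerEnds m e → ¬v ∉ layerRemaining m S T := by
    simp only [EdgeLabelling.IsExactCover, layerLabelling, Function.Embedding.coe_subtype,
      Subtype.range_coe, not_not, forall_and, Subtype.forall]
    exact and_congr_right fun _ => ⟨fun h v e he => h e he v, fun h e he v => h v e he⟩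
  have removed_inl : ∀ l, Sum.inl l ∉ layerRemaining m S T ↔ l ∈ S := by simp [layerRemaining]
  have removed_inr : ∀ l, Sum.inr l ∉ layerRemaining m S T ↔ l ∈ T := by simp [layerRemaining]
  rw [cover_iff, Sum.forall]
  refine and_congr (forall_congr' fun l => ?_) (forall_congr' fun l => ?_)
  · rw [existsUnique_mem_iff_exactlyOne_of_pair Sum.inl_ne_inr (inl_mem_layerEnds_iff l),
      removed_inl]
    rfl
  · rw [existsUnique_mem_iff_exactlyOne_of_pair Sum.inl_ne_inr (inr_mem_layerEnds_iff l),
      removed_inr]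
    rfl

theorem transferMatrix_apply {m : ℕ} (hm : 2 ≤ m) (S T : Finset (Fin m)) :
    transferMatrix m S T = Nat.card (LayerMatching S T) := by
  rw [transferMatrix, Matrix.of_apply, numPerfectMatchings, Nat.cast_inj]
  exact Nat.card_congr ((layerLabelling hm S T).perfectMatchingEquiv.trans
    ((Set.sumEquiv.toEquiv : Set (Fin m ⊕ Fin m) ≃ _).subtypeEquiv
      (isExactCover_layerLabelling_iff hm S T)))

theorem transferMatrix_nonneg (m : ℕ) (S T : Finset (Fin m)) : 0 ≤ transferMatrix m S T :=
  Nat.cast_nonneg _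

theorem one_le_transferMatrix_self {m : ℕ} (hm : 2 ≤ m) (S : Finset (Fin m)) :
    1 ≤ transferMatrix m S S := by
  have : Nonempty (LayerMatching S S) :=
    ⟨⟨({l | l ∉ S}, ∅), fun l => by simp [ExactlyOne, em], fun l => by simp [ExactlyOne, em]⟩⟩
  rw [transferMatrix_apply hm]
  exact_mod_cast Nat.card_pos

theorem ncard_preimage_finRotate_symm {m : ℕ} (U : Set (Fin m)) :
    ((finRotate m).symm ⁻¹' U).ncard = U.ncard :=
  Set.ncard_preimage_of_injective_subset_range (Equiv.injective _) (by simp)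

theorem IsLayerMatching.card_eq {m : ℕ} {S T : Finset (Fin m)} {D U : Set (Fin m)}
    (h : IsLayerMatching S T D U) : S.card = T.card := by
  have hS := card_add_ncard_of_exactlyOne (U := (finRotate m).symm ⁻¹' U) h.1
  have hT := card_add_ncard_of_exactlyOne h.2
  rw [ncard_preimage_finRotate_symm] at hS
  omega

theorem transferMatrix_eq_zero {m : ℕ} (hm : 2 ≤ m) {S T : Finset (Fin m)}
    (h : S.card ≠ T.card) : transferMatrix m S T = 0 := by
  have : IsEmpty (LayerMatching S T) := ⟨fun X => h X.2.card_eq⟩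
  rw [transferMatrix_apply hm, Nat.card_of_isEmpty, Nat.cast_zero]

/-- The rotation of a set of heights by one step. -/
def rotateSet {m : ℕ} : Finset (Fin m) ≃ Finset (Fin m) := (finRotate m).finsetCongr

theorem mem_rotateSet {m : ℕ} {S : Finset (Fin m)} {l : Fin m} :
    l ∈ rotateSet S ↔ (finRotate m).symm l ∈ S := by
  simp [rotateSet, Equiv.finsetCongr_apply, Finset.mem_map_equiv]

theorem card_rotateSet {m : ℕ} (S : Finset (Fin m)) : (rotateSet S).card = S.card := by
  simp [rotateSet]

/-- Reflecting the cycle between two slices exchanges its two sides up to a rotation. -/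
theorem isLayerMatching_rotateSet_iff {m : ℕ} {S T : Finset (Fin m)} {D U : Set (Fin m)} :
    IsLayerMatching (rotateSet S) T D U ↔ IsLayerMatching T S U (finRotate m ⁻¹' D) := by
  have left_iff : (∀ l, ExactlyOne (l ∈ rotateSet S) (l ∈ D) ((finRotate m).symm l ∈ U)) ↔
      ∀ l, ExactlyOne (l ∈ S) (l ∈ U) (finRotate m l ∈ D) := by
    rw [← (finRotate m).forall_congr_right]
    simp only [mem_rotateSet, Equiv.symm_apply_apply, exactlyOne_right_comm (b := _ ∈ D)]
  have right_iff : (∀ l, ExactlyOne (l ∈ T) (l ∈ D) (l ∈ U)) ↔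
      ∀ l, ExactlyOne (l ∈ T) (l ∈ U) ((finRotate m).symm l ∈ finRotate m ⁻¹' D) := by
    simp only [Set.mem_preimage, Equiv.apply_symm_apply, exactlyOne_right_comm (b := _ ∈ D)]
  exact (and_congr left_iff right_iff).trans and_comm

theorem transferMatrix_rotateSet {m : ℕ} (hm : 2 ≤ m) (S T : Finset (Fin m)) :
    transferMatrix m (rotateSet S) T = transferMatrix m T S := by
  rw [transferMatrix_apply hm, transferMatrix_apply hm, Nat.cast_inj]
  exact Nat.card_congr
    (((Equiv.prodComm _ _).trans
      ((Equiv.refl _).prodCongr (Equiv.Set.congr (finRotate m).symm))).subtypeEquiv fun DU => by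
        change _ ↔ IsLayerMatching T S DU.2 ((finRotate m).symm '' DU.1)
        rw [Equiv.image_symm_eq_preimage]
        exact isLayerMatching_rotateSet_iff)

/-- The number of perfect matchings of the `m`-gon after removal of `S`. -/
noncomputable def gonCount {m : ℕ} (S : Finset (Fin m)) : ℝ := Nat.card (GonMatching S)

theorem gonCount_nonneg {m : ℕ} (S : Finset (Fin m)) : 0 ≤ gonCount S := Nat.cast_nonneg _

theorem IsGonMatching.even_sub_card {m : ℕ} {S : Finset (Fin m)} {L : Set (Fin m)}
    (h : IsGonMatching S L) : Even (m - S.card) := by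
  have hcard := card_add_ncard_of_exactlyOne (U := (finRotate m).symm ⁻¹' L) h
  rw [ncard_preimage_finRotate_symm, Fintype.card_fin] at hcard
  exact ⟨L.ncard, by omega⟩

theorem gonCount_eq_zero {m : ℕ} {S : Finset (Fin m)} (h : ¬Even (m - S.card)) :
    gonCount S = 0 := by
  have : IsEmpty (GonMatching S) := ⟨fun X => h X.2.even_sub_card⟩
  rw [gonCount, Nat.card_of_isEmpty, Nat.cast_zero]

theorem isGonMatching_rotateSet_iff {m : ℕ} {S : Finset (Fin m)} {L : Set (Fin m)} :
    IsGonMatching (rotateSet S) L ↔ IsGonMatching S (finRotate m ⁻¹' L) := by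
  rw [IsGonMatching, ← (finRotate m).forall_congr_right]
  simp only [IsGonMatching, mem_rotateSet, Equiv.symm_apply_apply, Set.mem_preimage,
    Equiv.apply_symm_apply]

theorem gonCount_rotateSet {m : ℕ} (S : Finset (Fin m)) : gonCount (rotateSet S) = gonCount S := by
  rw [gonCount, gonCount, Nat.cast_inj]
  exact Nat.card_congr ((Equiv.Set.congr (finRotate m).symm).subtypeEquiv fun L => by
    change _ ↔ IsGonMatching S ((finRotate m).symm '' L)
    rw [Equiv.image_symm_eq_preimage]
    exact isGonMatching_rotateSet_iff)

theorem exists_gonCount_pos {m q : ℕ} (hq : 2 * q ≤ m) :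
    ∃ S : Finset (Fin m), S.card = m - 2 * q ∧ 0 < gonCount S := by
  refine ⟨Finset.univ.filter fun l => ¬(l : ℕ) < 2 * q, ?_, ?_⟩
  · rw [← Finset.compl_filter, Finset.card_compl, Fintype.card_fin, Fin.card_filter_val_lt,
      min_eq_right hq]
  · have pairs : IsGonMatching (Finset.univ.filter fun l : Fin m => ¬(l : ℕ) < 2 * q)
        {l | (l : ℕ) < 2 * q ∧ Even (l : ℕ)} := by
      intro l
      obtain ⟨x, rfl⟩ := (finRotate m).surjective l
      simp only [Equiv.symm_apply_apply, ExactlyOne, Finset.mem_filter, Finset.mem_univ, true_and,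
        Set.mem_ofPred_eq, val_finRotate, Nat.even_iff]
      have := x.2
      split_ifs <;> omega
    have : Nonempty (GonMatching _) := ⟨⟨_, pairs⟩⟩
    rw [gonCount]
    exact_mod_cast Nat.card_pos

/-! ### Perfect matchings of the barrel with prescribed slices -/

theorem finRotate_finRotate_ne_self {m : ℕ} (hm : 3 ≤ m) (l : Fin m) :
    finRotate m (finRotate m l) ≠ l := by
  refine Fin.ne_of_val_ne ?_
  rw [val_finRotate, val_finRotate]
  split_ifs <;> omega

theorem eq_finRotate_iff {m : ℕ} {l l' : Fin m} :
    l = finRotate m l' ↔ l' = (finRotate m).symm l := by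
  rw [Equiv.eq_symm_apply, eq_comm]

/-- Labels for the edges of the barrel fullerene. -/
inductive BarrelLabel (m k : ℕ) : Type
  | horizontal (j : Fin (k + 2)) (l : Fin m)
  | below (j : Fin (k + 1)) (l : Fin m)
  | above (j : Fin (k + 1)) (l : Fin m)
  | left (l : Fin m)
  | right (l : Fin m)

namespace BarrelLabel

variable {m k : ℕ}

/-- The source of an edge of the barrel fullerene, in the orientation chosen by `BarrelEdge`. -/
def source : BarrelLabel m k → BarrelVertex m k
  | horizontal j l => (j, l, false)
  | below j l => (j.castSucc, l, true)
  | above j l => (j.castSucc, finRotate m l, true)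
  | left l => (0, l, false)
  | right l => (Fin.last (k + 1), l, true)

/-- The target of an edge of the barrel fullerene, in the orientation chosen by `BarrelEdge`. -/
def target : BarrelLabel m k → BarrelVertex m k
  | horizontal j l => (j, l, true)
  | below j l => (j.succ, l, false)
  | above j l => (j.succ, l, false)
  | left l => (0, finRotate m l, false)
  | right l => (Fin.last (k + 1), finRotate m l, true)

/-- The endpoints of an edge of the barrel fullerene. -/
def ends (e : BarrelLabel m k) : Sym2 (BarrelVertex m k) := s(e.source, e.target)

theorem source_ne_target (hm : 2 ≤ m) (e : BarrelLabel m k) : e.source ≠ e.target := by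
  rcases e with _ | _ | _ | l | l <;>
    simp [source, target, -finRotate_apply, (finRotate_ne_self hm _).symm]

theorem ends_injective (hm : 3 ≤ m) : Function.Injective (ends (m := m) (k := k)) := by
  have rotate_ne := finRotate_ne_self (m := m) (by omega)
  have rotate_rotate_ne := finRotate_finRotate_ne_self hm
  have castSucc_ne_succ : ∀ j : Fin (k + 1), j.castSucc ≠ j.succ :=
    fun j => Fin.castSucc_lt_succ.ne
  rintro (⟨j, l⟩ | ⟨j, l⟩ | ⟨j, l⟩ | l | l) (⟨j', l'⟩ | ⟨j', l'⟩ | ⟨j', l'⟩ | l' | l') h <;>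
    simp only [ends, source, target, Sym2.eq_iff, Prod.mk.injEq, reduceCtorEq, and_false, or_false,
      and_true, false_or, false_and] at h <;> grind

end BarrelLabel

theorem barrelEdge_iff {m k : ℕ} {x y : BarrelVertex m k} :
    BarrelEdge m k x y ↔ ∃ e : BarrelLabel m k, e.source = x ∧ e.target = y := by
  constructor
  · rintro (⟨j, l⟩ | ⟨j, l⟩ | ⟨j, l⟩ | l | l)
    exacts [⟨.horizontal j l, rfl, rfl⟩, ⟨.below j l, rfl, rfl⟩, ⟨.above j l, rfl, rfl⟩,
      ⟨.left l, rfl, rfl⟩, ⟨.right l, rfl, rfl⟩]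
  · rintro ⟨⟨j, l⟩ | ⟨j, l⟩ | ⟨j, l⟩ | l | l, rfl, rfl⟩
    exacts [.horizontal j l, .below j l, .above j l, .leftGon l, .rightGon l]

theorem barrelFullerene_adj_iff {m k : ℕ} (hm : 2 ≤ m) (x y : BarrelVertex m k) :
    (barrelFullerene m k).Adj x y ↔ ∃ e : BarrelLabel m k, e.ends = s(x, y) := by
  rw [barrelFullerene, SimpleGraph.fromRel_adj, barrelEdge_iff, barrelEdge_iff, ← exists_or]
  simp only [BarrelLabel.ends, Sym2.eq_iff, and_comm (a := _ = y)]
  refine and_iff_right_of_imp ?_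
  rintro ⟨e, ⟨rfl, rfl⟩ | ⟨rfl, rfl⟩⟩
  exacts [e.source_ne_target hm, (e.source_ne_target hm).symm]

/-- The edges of the barrel fullerene as labels. -/
def barrelLabelling {m : ℕ} (hm : 3 ≤ m) (k : ℕ) :
    EdgeLabelling (barrelFullerene m k) (BarrelVertex m k) (BarrelLabel m k) where
  emb := Function.Embedding.refl _
  ends := BarrelLabel.ends
  ends_injective := BarrelLabel.ends_injective hm
  adj_iff := barrelFullerene_adj_iff (by omega)

section IsExactCover

variable {m k : ℕ} (X : Set (BarrelLabel m k))

theorem existsUnique_mem_ends_zero_iff (hm : 2 ≤ m) (l : Fin m) :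
    (∃! e : BarrelLabel m k, e ∈ X ∧ (0, l, false) ∈ e.ends) ↔
      ExactlyOne (.horizontal 0 l ∈ X) (.left l ∈ X) (.left ((finRotate m).symm l) ∈ X) := by
  have ne_symm : l ≠ (finRotate m).symm l := fun h =>
    finRotate_ne_self hm l ((Equiv.eq_symm_apply _).1 h)
  refine existsUnique_mem_iff_exactlyOne (by simp) (by simp) (by simpa using ne_symm) ?_
  rintro (⟨j', l'⟩ | ⟨j', l'⟩ | ⟨j', l'⟩ | l' | l') <;>
    simp [BarrelLabel.ends, BarrelLabel.source, BarrelLabel.target, eq_comm,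
      eq_finRotate_iff, Fin.succ_ne_zero, -finRotate_apply, -finRotate_symm_apply]

theorem existsUnique_mem_ends_succ_iff (j : Fin (k + 1)) (l : Fin m) :
    (∃! e : BarrelLabel m k, e ∈ X ∧ (j.succ, l, false) ∈ e.ends) ↔
      ExactlyOne (.horizontal j.succ l ∈ X) (.below j l ∈ X) (.above j l ∈ X) := by
  refine existsUnique_mem_iff_exactlyOne (by simp) (by simp) (by simp) ?_
  rintro (⟨j', l'⟩ | ⟨j', l'⟩ | ⟨j', l'⟩ | l' | l') <;>
    simp [BarrelLabel.ends, BarrelLabel.source, BarrelLabel.target, eq_comm]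

theorem existsUnique_mem_ends_castSucc_iff (j : Fin (k + 1)) (l : Fin m) :
    (∃! e : BarrelLabel m k, e ∈ X ∧ (j.castSucc, l, true) ∈ e.ends) ↔
      ExactlyOne (.horizontal j.castSucc l ∈ X) (.below j l ∈ X)
        (.above j ((finRotate m).symm l) ∈ X) := by
  refine existsUnique_mem_iff_exactlyOne (by simp) (by simp) (by simp) ?_
  rintro (⟨j', l'⟩ | ⟨j', l'⟩ | ⟨j', l'⟩ | l' | l') <;>
    simp [BarrelLabel.ends, BarrelLabel.source, BarrelLabel.target, eq_comm,
      eq_finRotate_iff, -finRotate_apply, -finRotate_symm_apply]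

theorem existsUnique_mem_ends_last_iff (hm : 2 ≤ m) (l : Fin m) :
    (∃! e : BarrelLabel m k, e ∈ X ∧ (Fin.last (k + 1), l, true) ∈ e.ends) ↔
      ExactlyOne (.horizontal (Fin.last (k + 1)) l ∈ X) (.right l ∈ X)
        (.right ((finRotate m).symm l) ∈ X) := by
  have ne_symm : l ≠ (finRotate m).symm l := fun h =>
    finRotate_ne_self hm l ((Equiv.eq_symm_apply _).1 h)
  have castSucc_ne_last : ∀ j : Fin (k + 1), j.castSucc ≠ Fin.last (k + 1) :=
    fun j => (Fin.castSucc_lt_last j).ne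
  refine existsUnique_mem_iff_exactlyOne (by simp) (by simp) (by simpa using ne_symm) ?_
  rintro (⟨j', l'⟩ | ⟨j', l'⟩ | ⟨j', l'⟩ | l' | l') <;>
    simp [BarrelLabel.ends, BarrelLabel.source, BarrelLabel.target, eq_comm,
      eq_finRotate_iff, castSucc_ne_last, -finRotate_apply, -finRotate_symm_apply]

theorem isExactCover_barrelLabelling_iff (hm : 3 ≤ m) {H : Fin (k + 2) → Finset (Fin m)}
    (hH : ∀ j l, .horizontal j l ∈ X ↔ l ∈ H j) :
    (barrelLabelling hm k).IsExactCover X ↔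
      IsGonMatching (H 0) {l | .left l ∈ X} ∧
      (∀ j : Fin (k + 1), IsLayerMatching (H j.castSucc) (H j.succ)
        {l | .below j l ∈ X} {l | .above j l ∈ X}) ∧
      IsGonMatching (H (Fin.last (k + 1))) {l | .right l ∈ X} := by
  have cover_iff : (barrelLabelling hm k).IsExactCover X ↔
      ∀ v, ∃! e : BarrelLabel m k, e ∈ X ∧ v ∈ e.ends :=
    and_iff_left fun _ _ v _ => ⟨v, rfl⟩
  have left_cover := existsUnique_mem_ends_zero_iff X (by omega)
  have right_cover := existsUnique_mem_ends_last_iff X (by omega)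
  have succ_cover := existsUnique_mem_ends_succ_iff X
  have castSucc_cover := existsUnique_mem_ends_castSucc_iff X
  simp only [hH] at left_cover right_cover succ_cover castSucc_cover
  rw [cover_iff]
  constructor
  · intro h
    exact ⟨fun l => (left_cover l).1 (h _),
      fun j => ⟨fun l => (castSucc_cover j l).1 (h _), fun l => (succ_cover j l).1 (h _)⟩,
      fun l => (right_cover l).1 (h _)⟩
  · rintro ⟨hleft, hlayer, hright⟩ ⟨j, l, _ | _⟩
    · cases j using Fin.cases with
      | zero => exact (left_cover l).2 (hleft l)
      | succ j => exact (succ_cover j l).2 ((hlayer j).2 l)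
    · cases j using Fin.lastCases with
      | last => exact (right_cover l).2 (hright l)
      | cast j => exact (castSucc_cover j l).2 ((hlayer j).1 l)

end IsExactCover

/-- The heights of the horizontal edges of a perfect matching in slice `j`. -/
noncomputable def horizontalSet {m k : ℕ} (M : PerfectMatching (barrelFullerene m k))
    (j : Fin (k + 2)) : Finset (Fin m) :=
  open Classical in Finset.univ.filter fun l => M.1.Adj (j, l, false) (j, l, true)

theorem mem_horizontalSet {m k : ℕ} {M : PerfectMatching (barrelFullerene m k)}
    {j : Fin (k + 2)} {l : Fin m} :
    l ∈ horizontalSet M j ↔ M.1.Adj (j, l, false) (j, l, true) := by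
  simp [horizontalSet]

theorem card_horizontalSet {m k : ℕ} (M : PerfectMatching (barrelFullerene m k))
    (j : Fin (k + 2)) : (horizontalSet M j).card = horizontalCount M j := by
  classical
  rw [horizontalCount, Nat.card_eq_fintype_card, Fintype.card_subtype, horizontalSet]

/-- The ways to complete given sets of horizontal edges to a perfect matching: the two end polygons
and the cycles between consecutive slices are matched independently. -/
abbrev SliceCompletion {m k : ℕ} (H : Fin (k + 2) → Finset (Fin m)) : Type :=
  GonMatching (H 0) × (∀ j : Fin (k + 1), LayerMatching (H j.castSucc) (H j.succ)) ×
    GonMatching (H (Fin.last (k + 1)))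

/-- The set of edges assembled from prescribed horizontal edges and a completion. -/
def completionLabels {m k : ℕ} {H : Fin (k + 2) → Finset (Fin m)} (c : SliceCompletion H) :
    Set (BarrelLabel m k) :=
  {e | match e with
    | .horizontal j l => l ∈ H j
    | .below j l => l ∈ (c.2.1 j).1.1
    | .above j l => l ∈ (c.2.1 j).1.2
    | .left l => l ∈ c.1.1
    | .right l => l ∈ c.2.2.1}

/-- Exact covers with prescribed horizontal edges, split into their pieces. -/
def exactCoverEquivSliceCompletion {m k : ℕ} (hm : 3 ≤ m) (H : Fin (k + 2) → Finset (Fin m)) :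
    {X : {X // (barrelLabelling hm k).IsExactCover X} //
      ∀ j l, .horizontal j l ∈ X.1 ↔ l ∈ H j} ≃ SliceCompletion H where
  toFun X :=
    have h := (isExactCover_barrelLabelling_iff X.1.1 hm X.2).1 X.1.2
    (⟨_, h.1⟩, fun j => ⟨({l | .below j l ∈ X.1.1}, {l | .above j l ∈ X.1.1}), h.2.1 j⟩, ⟨_, h.2.2⟩)
  invFun c :=
    ⟨⟨completionLabels c, (isExactCover_barrelLabelling_iff _ hm fun _ _ => Iff.rfl).2
      ⟨c.1.2, fun j => (c.2.1 j).2, c.2.2.2⟩⟩, fun _ _ => Iff.rfl⟩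
  left_inv X := by
    apply Subtype.ext
    apply Subtype.ext
    ext e
    cases e with
    | horizontal j l => exact (X.2 j l).symm
    | _ => exact Iff.rfl
  right_inv _ := rfl

theorem horizontalSet_eq_iff {m k : ℕ} (hm : 3 ≤ m) {M : PerfectMatching (barrelFullerene m k)}
    {H : Fin (k + 2) → Finset (Fin m)} :
    horizontalSet M = H ↔
      ∀ j l, .horizontal j l ∈ ((barrelLabelling hm k).perfectMatchingEquiv M).1 ↔ l ∈ H j := by
  rw [funext_iff]
  refine forall_congr' fun j => Finset.ext_iff.trans (forall_congr' fun l => ?_)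
  rw [mem_horizontalSet, ← (barrelLabelling hm k).mem_labelSet_iff (e := .horizontal j l) rfl]
  rfl

theorem card_horizontalSet_eq {m k : ℕ} (hm : 3 ≤ m) (H : Fin (k + 2) → Finset (Fin m)) :
    (Nat.card {M : PerfectMatching (barrelFullerene m k) // horizontalSet M = H} : ℝ) =
      gonCount (H 0) * (∏ j : Fin (k + 1), transferMatrix m (H j.castSucc) (H j.succ)) *
        gonCount (H (Fin.last (k + 1))) := by
  rw [Nat.card_congr (((barrelLabelling hm k).perfectMatchingEquiv.subtypeEquiv fun _ =>
    horizontalSet_eq_iff hm).trans (exactCoverEquivSliceCompletion hm H))]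
  simp only [Nat.card_prod, Nat.card_pi, Nat.cast_mul, Nat.cast_prod,
    transferMatrix_apply (m := m) (by omega), gonCount, mul_assoc]

theorem horizontalCount_eq_horizontalCount_zero {m k : ℕ} (hm : 3 ≤ m)
    (M : PerfectMatching (barrelFullerene m k)) (j : Fin (k + 2)) :
    horizontalCount M j = horizontalCount M 0 := by
  induction j using Fin.induction with
  | zero => rfl
  | succ j ih =>
    have hlayer := (exactCoverEquivSliceCompletion hm (horizontalSet M)
      ⟨(barrelLabelling hm k).perfectMatchingEquiv M, (horizontalSet_eq_iff hm).1 rfl⟩).2.1 j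
    rw [← ih, ← card_horizontalSet, ← card_horizontalSet, hlayer.2.card_eq]

/-! ### Transfer matrix formula for the sectors -/

section SectorCount

open scoped Matrix

theorem sum_prod_path_eq_dotProduct_pow_mulVec {α R : Type*} [Fintype α] [DecidableEq α]
    [CommSemiring R] (A : Matrix α α R) (n : ℕ) (f g : α → R) :
    ∑ H : Fin (n + 1) → α, f (H 0) * (∏ j : Fin n, A (H j.castSucc) (H j.succ)) *
      g (H (Fin.last n)) = f ⬝ᵥ A ^ n *ᵥ g := by
  induction n generalizing f with
  | zero =>
    rw [pow_zero, Matrix.one_mulVec, dotProduct, ← (Equiv.funUnique (Fin 1) α).sum_comp]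
    simp
  | succ n ih =>
    rw [pow_succ', ← Matrix.mulVec_mulVec, Matrix.dotProduct_mulVec, ← ih (f ᵥ* A),
      ← (Fin.consEquiv fun _ => α).sum_comp, Fintype.sum_prod_type, Finset.sum_comm]
    refine Finset.sum_congr rfl fun H _ => ?_
    rw [Matrix.vecMul, dotProduct, Finset.sum_mul, Finset.sum_mul]
    refine Finset.sum_congr rfl fun s _ => ?_
    simp only [Fin.consEquiv_apply, Fin.cons_zero, Fin.prod_univ_succ, Fin.cons_succ,
      Fin.castSucc_zero, ← Fin.succ_castSucc, ← Fin.succ_last]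
    ring

/-- The vector `gonCount` restricted to the sector `p`. -/
noncomputable def sectorGon (m p : ℕ) (S : Finset (Fin m)) : ℝ :=
  if S.card = p then gonCount S else 0

theorem sectorGon_nonneg {m p : ℕ} (S : Finset (Fin m)) : 0 ≤ sectorGon m p S := by
  unfold sectorGon
  split_ifs
  exacts [gonCount_nonneg S, le_rfl]

theorem sectorGon_rotateSet {m p : ℕ} (S : Finset (Fin m)) :
    sectorGon m p (rotateSet S) = sectorGon m p S := by
  rw [sectorGon, sectorGon, card_rotateSet, gonCount_rotateSet]

/-- The number of perfect matchings of `F(m,k)` with `p` horizontal edges in every slice. -/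
noncomputable def sectorCount (m k p : ℕ) : ℕ :=
  Nat.card {M : PerfectMatching (barrelFullerene m k) // ∀ j, horizontalCount M j = p}

theorem card_eq_of_prod_transferMatrix_ne_zero {m k : ℕ} (hm : 2 ≤ m)
    {H : Fin (k + 2) → Finset (Fin m)}
    (h : ∏ j : Fin (k + 1), transferMatrix m (H j.castSucc) (H j.succ) ≠ 0) (j : Fin (k + 2)) :
    (H j).card = (H 0).card := by
  induction j using Fin.induction with
  | zero => rfl
  | succ j ih =>
    by_contra hne
    exact Finset.prod_ne_zero_iff.1 h j (Finset.mem_univ j)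
      (transferMatrix_eq_zero hm fun hcard => hne (hcard.symm.trans ih))

theorem card_sector_horizontalSet_eq {m k p : ℕ} (hm : 3 ≤ m)
    (H : Fin (k + 2) → Finset (Fin m)) :
    (Nat.card {M : {M : PerfectMatching (barrelFullerene m k) // ∀ j, horizontalCount M j = p} //
      horizontalSet M.1 = H} : ℝ) =
      sectorGon m p (H 0) * (∏ j : Fin (k + 1), transferMatrix m (H j.castSucc) (H j.succ)) *
        sectorGon m p (H (Fin.last (k + 1))) := by
  by_cases hH : ∀ j, (H j).card = p
  · rw [sectorGon, sectorGon, if_pos (hH _), if_pos (hH _), ← card_horizontalSet_eq hm]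
    exact congrArg Nat.cast (Nat.card_congr (Equiv.subtypeSubtypeEquivSubtype
      (p := fun M => ∀ j, horizontalCount M j = p) (q := fun M => horizontalSet M = H)
      fun hM j => by rw [← card_horizontalSet, hM, hH]))
  · have : IsEmpty {M : {M : PerfectMatching (barrelFullerene m k) //
        ∀ j, horizontalCount M j = p} // horizontalSet M.1 = H} :=
      ⟨fun M => hH fun j => by rw [← M.2, card_horizontalSet, M.1.2]⟩
    rw [Nat.card_of_isEmpty, Nat.cast_zero, eq_comm]
    by_contra hne
    have hprod := right_ne_zero_of_mul (left_ne_zero_of_mul hne)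
    have h0 : (H 0).card = p := by
      by_contra h0
      exact left_ne_zero_of_mul (left_ne_zero_of_mul hne) (if_neg h0)
    exact hH fun j => (card_eq_of_prod_transferMatrix_ne_zero (by omega) hprod j).trans h0

theorem sectorCount_eq {m : ℕ} (hm : 3 ≤ m) (k p : ℕ) :
    (sectorCount m k p : ℝ) = sectorGon m p ⬝ᵥ transferMatrix m ^ (k + 1) *ᵥ sectorGon m p := by
  rw [← sum_prod_path_eq_dotProduct_pow_mulVec, sectorCount, Nat.card_congr (Equiv.sigmaFiberEquiv
    fun M : {M : PerfectMatching (barrelFullerene m k) // ∀ j, horizontalCount M j = p} =>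
      horizontalSet M.1).symm, Nat.card_sigma, Nat.cast_sum]
  exact Finset.sum_congr rfl fun H _ => card_sector_horizontalSet_eq hm H

theorem sectorGon_eq_zero {m p : ℕ} (hp : ¬Even (m - p)) : sectorGon m p = 0 := by
  funext S
  refine ite_eq_right_iff.2 fun hS => gonCount_eq_zero ?_
  rwa [hS]

theorem sectorCount_eq_zero {m : ℕ} (hm : 3 ≤ m) (k : ℕ) {p : ℕ} (hp : ¬Even (m - p)) :
    sectorCount m k p = 0 := by
  rw [← Nat.cast_eq_zero (R := ℝ), sectorCount_eq hm, sectorGon_eq_zero hp, zero_dotProduct]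

theorem numPerfectMatchings_eq_sectorCount_add (m k p : ℕ) :
    numPerfectMatchings (barrelFullerene m k) = sectorCount m k p +
      Nat.card {M : PerfectMatching (barrelFullerene m k) // ∃ j, horizontalCount M j ≠ p} := by
  classical
  rw [numPerfectMatchings, sectorCount, ← Nat.card_congr (Equiv.sumCompl fun M =>
    ∀ j, horizontalCount M j = p), Nat.card_sum]
  simp only [not_forall, ne_eq]

theorem card_horizontalCount_ne_eq_sum {m : ℕ} (hm : 3 ≤ m) (k p₀ : ℕ) :
    Nat.card {M : PerfectMatching (barrelFullerene m k) // ∃ j, horizontalCount M j ≠ p₀} =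
      ∑ p ∈ (Finset.range (m + 1)).erase p₀, sectorCount m k p := by
  classical
  have := Fintype.ofFinite (PerfectMatching (barrelFullerene m k))
  have forall_eq_iff : ∀ (M : PerfectMatching (barrelFullerene m k)) p,
      (∀ j, horizontalCount M j = p) ↔ horizontalCount M 0 = p := fun M p =>
    ⟨fun h => h 0, fun h j => (horizontalCount_eq_horizontalCount_zero hm M j).trans h⟩
  have maps_to : ∀ M ∈ Finset.univ.filter fun M : PerfectMatching (barrelFullerene m k) =>
      horizontalCount M 0 ≠ p₀, horizontalCount M 0 ∈ (Finset.range (m + 1)).erase p₀ := by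
    intro M hM
    have hle : horizontalCount M 0 ≤ m := by
      simpa [card_horizontalSet] using Finset.card_le_univ (horizontalSet M 0)
    exact Finset.mem_erase.2 ⟨(Finset.mem_filter.1 hM).2, Finset.mem_range_succ_iff.2 hle⟩
  simp only [sectorCount, ne_eq, ← not_forall, forall_eq_iff, Nat.card_eq_fintype_card,
    Fintype.card_subtype]
  rw [Finset.card_eq_sum_card_fiberwise maps_to]
  refine Finset.sum_congr rfl fun p hp => ?_
  rw [Finset.filter_filter]
  congr 1
  refine Finset.filter_congr fun M _ => and_iff_right_of_imp fun h => ?_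
  rw [h]
  exact Finset.ne_of_mem_erase hp

end SectorCount

/-! ### Free fermion hopping -/

/-- The product of `2 sin (x j - x i)` over all pairs `i < j`. -/
noncomputable def sinProd {n : ℕ} (x : Fin n → ℝ) : ℝ :=
  ∏ i, ∏ j ∈ Finset.Ioi i, 2 * Real.sin (x j - x i)

/-- The product of the `n` numbers `2 cos (h a / 2)`, for `a = -(n-1), -(n-3), …, n-1`. -/
noncomputable def cosProd (n : ℕ) (h : ℝ) : ℝ :=
  ∏ a ∈ Finset.range n, 2 * Real.cos (h / 2 * (2 * (a : ℝ) - (n - 1)))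

theorem sinProd_sub_const {n : ℕ} (x : Fin n → ℝ) (c : ℝ) :
    sinProd (fun b => x b - c) = sinProd x := by
  simp only [sinProd, sub_sub_sub_cancel_right]

theorem sinProd_nonneg {n : ℕ} {x : Fin n → ℝ}
    (hx : ∀ i j, i < j → x j - x i ∈ Set.Icc 0 Real.pi) : 0 ≤ sinProd x :=
  Finset.prod_nonneg fun i _ => Finset.prod_nonneg fun j hj =>
    mul_nonneg zero_le_two (Real.sin_nonneg_of_mem_Icc (hx i j (Finset.mem_Ioi.1 hj)))

theorem sinProd_sq {n : ℕ} (x : Fin n → ℝ) :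
    sinProd x ^ 2 = ∏ i, ∏ j ∈ {i}ᶜ, |2 * Real.sin (x i - x j)| := by
  rw [← Finset.prod_prod_Ioi_mul_eq_prod_prod_off_diag fun j i => |2 * Real.sin (x i - x j)|,
    sinProd, ← Finset.prod_pow]
  refine Finset.prod_congr rfl fun i _ => ?_
  rw [← Finset.prod_pow]
  refine Finset.prod_congr rfl fun j _ => ?_
  rw [← neg_sub (x j), Real.sin_neg, mul_neg, abs_neg, abs_mul_abs_self, sq]

section SinVandermonde

open Complex

/-- The matrix with entries `exp ((2 a - (n - 1)) x_b I)`, for which the Vandermonde determinant is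
`sinProd x` up to a constant. -/
noncomputable def expVandermonde {n : ℕ} (x : Fin n → ℝ) : Matrix (Fin n) (Fin n) ℂ :=
  Matrix.projVandermonde (fun b => exp (x b * I)) (fun b => exp (-(x b * I)))

theorem expVandermonde_apply {n : ℕ} (x : Fin n → ℝ) (b a : Fin n) :
    expVandermonde x b a = exp ((2 * (a : ℂ) - (n - 1)) * (x b * I)) := by
  rw [expVandermonde, Matrix.projVandermonde_apply, ← Complex.exp_nat_mul, ← Complex.exp_nat_mul,
    ← Complex.exp_add, Fin.val_rev, Nat.cast_sub a.2]
  push_cast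
  ring_nf

theorem det_expVandermonde {n : ℕ} (x : Fin n → ℝ) :
    (expVandermonde x).det = (∏ i : Fin n, ∏ _j ∈ Finset.Ioi i, I) * (sinProd x : ℂ) := by
  rw [expVandermonde, Matrix.det_projVandermonde, sinProd]
  push_cast
  simp only [← Finset.prod_mul_distrib]
  refine Finset.prod_congr rfl fun i _ => Finset.prod_congr rfl fun j _ => ?_
  rw [← Complex.exp_add, ← Complex.exp_add, Complex.two_sin,
    show (x j : ℂ) * I + -(x i * I) = (x j - x i) * I by ring,
    show (x i : ℂ) * I + -(x j * I) = -(x j - x i) * I by ring]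
  linear_combination (exp ((x j - x i) * I) - exp (-(x j - x i) * I)) * I_sq

theorem expVandermonde_piecewise {n : ℕ} (s : Finset (Fin n)) (x y : Fin n → ℝ) :
    expVandermonde (s.piecewise x y) = s.piecewise (expVandermonde x) (expVandermonde y) := by
  ext b a
  by_cases hb : b ∈ s <;> simp [expVandermonde_apply, Finset.piecewise, hb]

theorem expVandermonde_add_expVandermonde_sub {n : ℕ} (x : Fin n → ℝ) (h : ℝ) :
    expVandermonde x + expVandermonde (fun b => x b - h) =
      expVandermonde (fun b => x b - h / 2) *
        Matrix.diagonal fun a : Fin n => 2 * cos (h / 2 * (2 * (a : ℂ) - (n - 1))) := by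
  ext b a
  rw [Matrix.mul_diagonal, Matrix.add_apply]
  simp only [expVandermonde_apply]
  rw [Complex.two_cos, mul_add, ← Complex.exp_add, ← Complex.exp_add]
  push_cast
  ring_nf

/-- The determinant is additive in each row, so hopping each point independently amounts to adding
two Vandermonde matrices; their sum is again one, up to a diagonal factor. -/
theorem sum_sinProd_piecewise {n : ℕ} (x : Fin n → ℝ) (h : ℝ) :
    ∑ s : Finset (Fin n), sinProd (s.piecewise x fun b => x b - h) = cosProd n h * sinProd x := by
  have det_add : (expVandermonde x + expVandermonde fun b => x b - h).det =
      ∑ s : Finset (Fin n), (expVandermonde (s.piecewise x fun b => x b - h)).det := by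
    simp only [expVandermonde_piecewise]
    exact (Matrix.detRowAlternating (R := ℂ) (n := Fin n)).map_add_univ _ _
  have I_prod_ne_zero : (∏ i : Fin n, ∏ _j ∈ Finset.Ioi i, I) ≠ 0 :=
    Finset.prod_ne_zero_iff.2 fun i _ => Finset.prod_ne_zero_iff.2 fun j _ => I_ne_zero
  rw [expVandermonde_add_expVandermonde_sub, Matrix.det_mul, Matrix.det_diagonal] at det_add
  simp only [det_expVandermonde, sinProd_sub_const, ← Finset.mul_sum, mul_assoc] at det_add
  apply Complex.ofReal_injective
  rw [cosProd, Finset.prod_range]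
  push_cast
  rw [← mul_left_cancel₀ I_prod_ne_zero det_add, mul_comm]

end SinVandermonde

theorem sin_pi_div_mul_intCast_eq_zero_iff {m : ℕ} (hm : m ≠ 0) {a : ℤ} :
    Real.sin (Real.pi / m * a) = 0 ↔ (m : ℤ) ∣ a := by
  have hm' : (m : ℝ) ≠ 0 := Nat.cast_ne_zero.2 hm
  rw [Real.sin_eq_zero_iff]
  refine exists_congr fun k => ?_
  rw [← mul_div_right_comm, eq_div_iff hm', mul_right_comm, mul_comm Real.pi,
    mul_left_inj' Real.pi_ne_zero, mul_comm]
  norm_cast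
  exact eq_comm

theorem abs_sin_pi_div_mul_intCast_congr {m : ℕ} {a b : ℤ} (h : a ≡ b [ZMOD m]) :
    |Real.sin (Real.pi / m * a)| = |Real.sin (Real.pi / m * b)| := by
  obtain rfl | hm := eq_or_ne m 0
  · simp
  have hm' : (m : ℝ) ≠ 0 := Nat.cast_ne_zero.2 hm
  obtain ⟨k, hk⟩ := h.dvd
  rw [eq_add_of_sub_eq' hk]
  push_cast
  rw [mul_add, ← mul_assoc, div_mul_cancel₀ _ hm', mul_comm Real.pi, Real.sin_add_int_mul_pi,
    abs_mul, abs_zpow, abs_neg, abs_one, one_zpow, one_mul]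

/-- The modulus of the Vandermonde product of the `m`-th roots of unity with indices in `N`, written
as a square root because both orders of each pair occur in the product. -/
noncomputable def rootVandermonde {m : ℕ} (N : Finset (Fin m)) : ℝ :=
  √(∏ x ∈ N, ∏ y ∈ N.erase x, |2 * Real.sin (Real.pi / m * ((x : ℕ) - (y : ℕ) : ℤ))|)

theorem rootVandermonde_pos {m : ℕ} (N : Finset (Fin m)) : 0 < rootVandermonde N := by
  refine Real.sqrt_pos.2 (Finset.prod_pos fun x _ => Finset.prod_pos fun y hy =>
    abs_pos.2 (mul_ne_zero two_ne_zero ?_))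
  rw [Ne, sin_pi_div_mul_intCast_eq_zero_iff x.pos.ne']
  intro hdvd
  have hxy : ((x : ℕ) - (y : ℕ) : ℤ) = 0 := Int.eq_zero_of_abs_lt_dvd hdvd (abs_lt.2 (by omega))
  exact Finset.ne_of_mem_erase hy (Fin.ext (by omega))

theorem sinProd_eq_rootVandermonde {m n : ℕ} {g : Fin n → ℤ} {τ : Fin n → Fin m}
    (hτ : ∀ b, g b ≡ (τ b : ℕ) [ZMOD m]) (hinj : Function.Injective τ)
    (hg : ∀ i j, i < j → g j - g i ∈ Set.Icc 0 (m : ℤ)) :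
    sinProd (fun b => Real.pi / m * g b) = rootVandermonde (Finset.univ.image τ) := by
  have hnonneg : 0 ≤ sinProd fun b => Real.pi / m * g b := by
    refine sinProd_nonneg fun i j hij => ?_
    have hm : (0 : ℝ) < m := by exact_mod_cast (τ i).pos
    have hlower : (0 : ℝ) ≤ g j - g i := by exact_mod_cast (hg i j hij).1
    have hupper : (g j : ℝ) - g i ≤ m := by exact_mod_cast (hg i j hij).2
    rw [← mul_sub]
    refine ⟨mul_nonneg (div_nonneg Real.pi_pos.le hm.le) hlower, ?_⟩
    rw [div_mul_eq_mul_div, div_le_iff₀ hm]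
    exact mul_le_mul_of_nonneg_left hupper Real.pi_pos.le
  rw [rootVandermonde, ← Real.sqrt_sq hnonneg, sinProd_sq, Finset.prod_image hinj.injOn]
  congr 1
  refine Finset.prod_congr rfl fun i _ => ?_
  rw [← Finset.image_erase hinj, Finset.prod_image hinj.injOn, Finset.compl_singleton]
  refine Finset.prod_congr rfl fun j _ => ?_
  rw [abs_mul, abs_mul, ← abs_sin_pi_div_mul_intCast_congr ((hτ i).sub (hτ j)), Int.cast_sub,
    mul_sub]

theorem sinProd_eq_zero {m n : ℕ} {g : Fin n → ℤ} {τ : Fin n → Fin m}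
    (hτ : ∀ b, g b ≡ (τ b : ℕ) [ZMOD m]) (hinj : ¬Function.Injective τ) :
    sinProd (fun b => Real.pi / m * g b) = 0 := by
  obtain ⟨i, j, heq, hij⟩ : ∃ i j, τ i = τ j ∧ i < j := by
    obtain ⟨i, j, heq, hne⟩ := Function.not_injective_iff.1 hinj
    rcases lt_or_gt_of_ne hne with hlt | hlt
    exacts [⟨i, j, heq, hlt⟩, ⟨j, i, heq.symm, hlt⟩]
  have hdvd : (m : ℤ) ∣ g j - g i := ((hτ i).trans (heq ▸ (hτ j).symm)).dvd
  refine Finset.prod_eq_zero (Finset.mem_univ i) (Finset.prod_eq_zero (Finset.mem_Ioi.2 hij) ?_)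
  rw [← mul_sub, ← Int.cast_sub, (sin_pi_div_mul_intCast_eq_zero_iff (τ i).pos.ne').2 hdvd,
    mul_zero]

theorem val_finRotate_modEq {m : ℕ} (l : Fin m) :
    ((finRotate m l : ℕ) : ℤ) ≡ (l : ℕ) + 1 [ZMOD m] := by
  rw [val_finRotate, Int.modEq_iff_dvd]
  split_ifs with h
  · exact ⟨1, by push_cast; omega⟩
  · exact ⟨0, by push_cast; omega⟩

theorem rootVandermonde_map_finRotate {m : ℕ} (N : Finset (Fin m)) :
    rootVandermonde (N.map (finRotate m).toEmbedding) = rootVandermonde N := by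
  rw [rootVandermonde, rootVandermonde, Finset.prod_map]
  congr 1
  refine Finset.prod_congr rfl fun x _ => ?_
  rw [← Finset.map_erase, Finset.prod_map]
  refine Finset.prod_congr rfl fun y _ => ?_
  have hmod := (val_finRotate_modEq x).sub (val_finRotate_modEq y)
  rw [add_sub_add_right_eq_sub] at hmod
  rw [abs_mul, abs_mul, ← abs_sin_pi_div_mul_intCast_congr hmod]
  rfl

theorem forall_exactlyOne_iff_exists_image {ι α : Type*} [Fintype ι] [Fintype α] [DecidableEq α]
    {s : ι → α} (hs : Function.Injective s) {S : Finset α} (hS : Finset.univ.image s = Sᶜ)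
    {D D' : Set α} :
    (∀ l, ExactlyOne (l ∈ S) (l ∈ D) (l ∈ D')) ↔
      ∃ E : Finset ι, s '' E = D ∧ s '' (E : Set ι)ᶜ = D' := by
  classical
  have hmem : ∀ l, l ∉ S ↔ ∃ b, s b = l := fun l => by
    rw [← Finset.mem_compl, ← hS]
    simp
  constructor
  · intro h
    unfold ExactlyOne at h
    refine ⟨Finset.univ.filter fun b => s b ∈ D, ?_, ?_⟩ <;> ext l <;> have := h l <;>
      have := hmem l <;> simp only [Set.mem_image, SetLike.mem_coe, Set.mem_compl_iff,
        Finset.mem_filter, Finset.mem_univ, true_and] <;> grind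
  · rintro ⟨E, rfl, rfl⟩ l
    have := hmem l
    simp only [ExactlyOne, Set.mem_image, SetLike.mem_coe, Set.mem_compl_iff]
    grind [Function.Injective]

theorem forall_exactlyOne_image_iff {ι α : Type*} [Fintype ι] [Fintype α] [DecidableEq α]
    {f : ι → α} {E : Finset ι} (hE : Set.InjOn f E) (hE' : Set.InjOn f (E : Set ι)ᶜ)
    {T : Finset α} :
    (∀ l, ExactlyOne (l ∈ T) (l ∈ f '' E) (l ∈ f '' (E : Set ι)ᶜ)) ↔
      Function.Injective f ∧ Finset.univ.image f = Tᶜ := by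
  simp only [ExactlyOne, Set.mem_image, SetLike.mem_coe, Set.mem_compl_iff, Set.InjOn,
    Finset.ext_iff, Finset.mem_image, Finset.mem_univ, true_and, Finset.mem_compl] at *
  constructor
  · intro h
    refine ⟨fun a b hab => ?_, fun l => ?_⟩
    · have := h (f a)
      grind
    · have := h l
      grind
  · rintro ⟨hf, hT⟩ l
    have := hT l
    grind [Function.Injective]

/-- The positions of the particles `s` after those with index outside `E` have moved back by one
step on the cycle. -/
def hop {m : ℕ} {ι : Type*} [DecidableEq ι] (s : ι → Fin m) (E : Finset ι) (b : ι) : Fin m :=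
  if b ∈ E then s b else (finRotate m).symm (s b)

section Hop

variable {m : ℕ} {ι : Type*} [DecidableEq ι] {s : ι → Fin m} {S T : Finset (Fin m)}

theorem hop_image (s : ι → Fin m) (E : Finset ι) : hop s E '' E = s '' E :=
  Set.image_congr fun _ hb => if_pos hb

theorem hop_image_compl (s : ι → Fin m) (E : Finset ι) :
    hop s E '' (E : Set ι)ᶜ = (finRotate m).symm '' (s '' (E : Set ι)ᶜ) := by
  rw [← Set.image_comp]
  exact Set.image_congr fun _ hb => if_neg hb

theorem injOn_hop (hs : Function.Injective s) (E : Finset ι) : Set.InjOn (hop s E) E :=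
  hs.injOn.congr fun _ hb => (if_pos hb).symm

theorem injOn_hop_compl (hs : Function.Injective s) (E : Finset ι) :
    Set.InjOn (hop s E) (E : Set ι)ᶜ :=
  ((finRotate m).symm.injective.comp hs).injOn.congr fun _ hb => (if_neg hb).symm

theorem isLayerMatching_iff_exists_hop [Fintype ι] (hs : Function.Injective s)
    (hS : Finset.univ.image s = Sᶜ) {D U : Set (Fin m)} :
    IsLayerMatching S T D U ↔ ∃ E : Finset ι, (Function.Injective (hop s E) ∧
      Finset.univ.image (hop s E) = Tᶜ) ∧ hop s E '' E = D ∧ hop s E '' (E : Set ι)ᶜ = U := by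
  have left_iff : (∀ l, ExactlyOne (l ∈ S) (l ∈ D) ((finRotate m).symm l ∈ U)) ↔
      ∃ E : Finset ι, hop s E '' E = D ∧ hop s E '' (E : Set ι)ᶜ = U := by
    refine (forall_exactlyOne_iff_exists_image (D' := (finRotate m).symm ⁻¹' U) hs hS).trans ?_
    simp only [hop_image, hop_image_compl, Equiv.eq_preimage_iff_image_eq]
  rw [IsLayerMatching, left_iff]
  constructor
  · rintro ⟨⟨E, rfl, rfl⟩, right⟩
    exact ⟨E, (forall_exactlyOne_image_iff (injOn_hop hs E) (injOn_hop_compl hs E)).1 right,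
      rfl, rfl⟩
  · rintro ⟨E, hE, rfl, rfl⟩
    exact ⟨⟨E, rfl, rfl⟩,
      (forall_exactlyOne_image_iff (injOn_hop hs E) (injOn_hop_compl hs E)).2 hE⟩

theorem card_layerMatching [Fintype ι] (hs : Function.Injective s)
    (hS : Finset.univ.image s = Sᶜ) :
    Nat.card (LayerMatching S T) = Nat.card {E : Finset ι //
      Function.Injective (hop s E) ∧ Finset.univ.image (hop s E) = Tᶜ} := by
  refine (Nat.card_eq_of_bijective (fun E => ⟨(hop s E '' E, hop s E '' (E : Set ι)ᶜ),
    (isLayerMatching_iff_exists_hop hs hS).2 ⟨E, E.2, rfl, rfl⟩⟩) ⟨?_, ?_⟩).symm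
  · intro E E' h
    have himage := (Prod.ext_iff.1 (Subtype.ext_iff.1 h)).1
    simp only [hop_image] at himage
    exact Subtype.ext (Finset.coe_injective (hs.image_injective himage))
  · rintro ⟨⟨D, U⟩, hDU⟩
    obtain ⟨E, hE, rfl, rfl⟩ := (isLayerMatching_iff_exists_hop hs hS).1 hDU
    exact ⟨⟨E, hE⟩, rfl⟩

open scoped Matrix in
theorem transferMatrix_mulVec_apply [Fintype ι] (hm : 2 ≤ m) (hs : Function.Injective s)
    (hS : Finset.univ.image s = Sᶜ) (f : Finset (Fin m) → ℝ) :
    (transferMatrix m *ᵥ fun T => f Tᶜ) S = ∑ E : Finset ι, open Classical in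
      if Function.Injective (hop s E) then f (Finset.univ.image (hop s E)) else 0 := by
  classical
  have entry : ∀ T, transferMatrix m S T = ∑ E : Finset ι,
      if Function.Injective (hop s E) ∧ Finset.univ.image (hop s E) = Tᶜ then (1 : ℝ) else 0 :=
    fun T => by
      rw [transferMatrix_apply hm, card_layerMatching hs hS, Nat.card_eq_fintype_card,
        Fintype.card_subtype, Finset.sum_boole]
  simp only [Matrix.mulVec, dotProduct, entry, Finset.sum_mul]
  rw [Finset.sum_comm]
  refine Finset.sum_congr rfl fun E _ => ?_
  simp only [← compl_inj_iff (x := Finset.univ.image _), compl_compl, ite_and, ite_mul, one_mul,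
    zero_mul]
  split_ifs <;> simp

end Hop

theorem sinProd_piecewise_hop {m n : ℕ} {s : Fin n → Fin m} (hs : StrictMono s)
    (E : Finset (Fin n)) :
    sinProd (E.piecewise (fun b => Real.pi / m * (s b : ℕ))
      fun b => Real.pi / m * (s b : ℕ) - Real.pi / m) = open Classical in
      if Function.Injective (hop s E) then rootVandermonde (Finset.univ.image (hop s E))
      else 0 := by
  set g : Fin n → ℤ := fun b => if b ∈ E then (s b : ℕ) else (s b : ℕ) - 1 with hg
  have hmod : ∀ b, g b ≡ (hop s E b : ℕ) [ZMOD m] := by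
    intro b
    by_cases hb : b ∈ E
    · simp [hg, hop, hb]
    · have := (val_finRotate_modEq ((finRotate m).symm (s b))).sub_right 1
      simpa [hg, hop, hb, -finRotate_apply, -finRotate_symm_apply] using this
  have hgap : ∀ i j, i < j → g j - g i ∈ Set.Icc 0 (m : ℤ) := by
    intro i j hij
    have hlt : (s i : ℕ) < s j := hs hij
    simp only [hg, Set.mem_Icc]
    split_ifs <;> omega
  have hpiecewise : (E.piecewise (fun b => Real.pi / m * (s b : ℕ))
      fun b => Real.pi / m * (s b : ℕ) - Real.pi / m) = fun b => Real.pi / m * g b := by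
    ext b
    by_cases hb : b ∈ E <;> simp [hg, hb, mul_sub]
  rw [hpiecewise]
  split_ifs with hinj
  · exact sinProd_eq_rootVandermonde hmod hinj hgap
  · exact sinProd_eq_zero hmod hinj

open scoped Matrix in
theorem transferMatrix_mulVec_rootVandermonde {m : ℕ} (hm : 2 ≤ m) (S : Finset (Fin m)) :
    (transferMatrix m *ᵥ fun T => rootVandermonde Tᶜ) S =
      cosProd (m - S.card) (Real.pi / m) * rootVandermonde Sᶜ := by
  have hcard : Sᶜ.card = m - S.card := by rw [Finset.card_compl, Fintype.card_fin]
  set s : Fin (m - S.card) ↪o Fin m := Sᶜ.orderEmbOfFin hcard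
  have hS : Finset.univ.image s = Sᶜ := Finset.image_orderEmbOfFin_univ _ hcard
  have hsinProd : sinProd (fun b => Real.pi / m * (s b : ℕ)) = rootVandermonde Sᶜ := by
    rw [← hS]
    refine sinProd_eq_rootVandermonde (g := fun b => (s b : ℕ)) (fun _ => rfl) s.injective
      fun i j hij => ?_
    have hlt : (s i : ℕ) < s j := s.strictMono hij
    simp only [Set.mem_Icc]
    omega
  rw [transferMatrix_mulVec_apply hm s.injective hS, ← hsinProd, ← sum_sinProd_piecewise]
  exact Finset.sum_congr rfl fun E _ => (sinProd_piecewise_hop s.strictMono E).symm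

/-! ### The eigenvalues as trigonometric products -/

theorem cosProd_factor_pos {m n a : ℕ} (ha : a < n) (hn : n ≤ m) :
    0 < 2 * Real.cos (Real.pi / m / 2 * (2 * (a : ℝ) - (n - 1))) := by
  have ha' : (a : ℝ) + 1 ≤ n := by exact_mod_cast ha
  have hn' : (n : ℝ) ≤ m := by exact_mod_cast hn
  have hm : (0 : ℝ) < m := by linarith [(a.cast_nonneg : (0 : ℝ) ≤ a)]
  have hangle : 0 < Real.pi / m / 2 :=
    div_pos (div_pos Real.pi_pos hm) two_pos
  have hhalf : Real.pi / m / 2 * m = Real.pi / 2 := by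
    rw [div_mul_eq_mul_div, div_mul_cancel₀ _ hm.ne']
  refine mul_pos two_pos (Real.cos_pos_of_mem_Ioo ⟨?_, ?_⟩) <;>
    nlinarith [(a.cast_nonneg : (0 : ℝ) ≤ a)]

theorem cosProd_pos {m n : ℕ} (hn : n ≤ m) : 0 < cosProd n (Real.pi / m) :=
  Finset.prod_pos fun _ ha => cosProd_factor_pos (Finset.mem_range.1 ha) hn

theorem cosProd_add_two (n : ℕ) (h : ℝ) :
    cosProd (n + 2) h = cosProd n h * (2 * Real.cos (h / 2 * (n + 1))) ^ 2 := by
  rw [cosProd, Finset.prod_range_succ, Finset.prod_range_succ', cosProd]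
  push_cast
  have hshift (a : ℝ) : h / 2 * (2 * (a + 1) - (n + 2 - 1)) = h / 2 * (2 * a - (n - 1)) := by ring
  rw [show h / 2 * (2 * 0 - ((n : ℝ) + 2 - 1)) = -(h / 2 * (n + 1)) by ring, Real.cos_neg]
  simp only [hshift]
  rw [show h / 2 * (2 * n - (n - 1)) = h / 2 * (n + 1) by ring]
  ring

theorem cosProd_eq_prod_norm {m n : ℕ} (hn : n ≤ m) :
    cosProd n (Real.pi / m) = ∏ a ∈ Finset.range n,
      ‖Complex.exp (Complex.I * ↑(Real.pi / m * (2 * a + 1 + (m - n)))) - 1‖ := by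
  refine Finset.prod_congr rfl fun a ha => ?_
  have han : a < n := Finset.mem_range.1 ha
  have hm : (m : ℝ) ≠ 0 := Nat.cast_ne_zero.2 (by omega)
  rw [Complex.norm_exp_I_mul_ofReal_sub_one, ← abs_of_pos (cosProd_factor_pos han hn),
    Real.norm_eq_abs, ← Real.sin_add_pi_div_two]
  congr 3
  field_simp
  ring

open Complex in
/-- At the full level the phases are the `m`-th roots of `-1`. -/
theorem cosProd_self {m : ℕ} (hm : m ≠ 0) : cosProd m (Real.pi / m) = 2 := by
  have hm' : (m : ℂ) ≠ 0 := Nat.cast_ne_zero.2 hm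
  have hroot : exp (Real.pi / m * I) ^ m = -1 := by
    rw [← Complex.exp_nat_mul, ← mul_assoc, mul_div_cancel₀ _ hm', exp_pi_mul_I]
  have heval := congrArg (fun P => ‖P.eval 1‖)
    (X_pow_sub_C_eq_prod (isPrimitiveRoot_exp m hm) (Nat.pos_of_ne_zero hm) hroot)
  simp only [Polynomial.eval_sub, Polynomial.eval_pow, Polynomial.eval_X, Polynomial.eval_C,
    Polynomial.eval_prod, one_pow, norm_prod, sub_neg_eq_add, one_add_one_eq_two,
    Complex.norm_two] at heval
  rw [heval, cosProd_eq_prod_norm le_rfl]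
  refine Finset.prod_congr rfl fun a _ => ?_
  rw [norm_sub_rev, ← Complex.exp_nat_mul, ← Complex.exp_add]
  push_cast
  ring_nf

open Complex in
/-- One level below, the phases are the `m`-th roots of unity other than `1`. -/
theorem cosProd_sub_one {m : ℕ} (hm : m ≠ 0) : cosProd (m - 1) (Real.pi / m) = m := by
  obtain ⟨n, rfl⟩ := Nat.exists_eq_succ_of_ne_zero hm
  have hprod := congrArg norm (isPrimitiveRoot_exp (n + 1) hm).prod_one_sub_pow_eq_order
  rw [norm_prod, ← Nat.cast_succ, Complex.norm_natCast] at hprod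
  rw [cosProd_eq_prod_norm (Nat.sub_le _ _)]
  refine Eq.trans ?_ hprod
  refine Finset.prod_congr rfl fun a _ => ?_
  rw [norm_sub_rev, ← Complex.exp_nat_mul]
  push_cast
  ring_nf

theorem lamMax_add_two (m p : ℕ) :
    lamMax m (p + 2) = lamMax m p / (4 * Real.sin (Real.pi * (p + 1) / (2 * m)) ^ 2) := by
  have heven : Even (p + 2) ↔ Even p := by simp [Nat.even_add]
  simp only [lamMax, heven, Nat.add_div_right p two_pos]
  split_ifs with hp
  · obtain ⟨q, rfl⟩ := hp.two_dvd
    rw [Finset.prod_range_succ, div_div, Nat.mul_div_cancel_left q two_pos]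
    push_cast
    rfl
  · obtain ⟨q, rfl⟩ := Nat.not_even_iff_odd.1 hp
    rw [Finset.prod_Icc_succ_top (by omega), div_div, show (2 * q + 1) / 2 = q by omega]
    push_cast
    rw [show Real.pi * (2 * (q : ℝ) + 1 + 1) = 2 * (Real.pi * (q + 1)) by ring,
      mul_div_mul_left _ _ two_ne_zero]

theorem lamMax_eq_cosProd {m : ℕ} (hm : m ≠ 0) :
    ∀ p ≤ m, lamMax m p = cosProd (m - p) (Real.pi / m)
  | 0, _ => by rw [Nat.sub_zero, cosProd_self hm]; simp [lamMax]
  | 1, _ => by rw [cosProd_sub_one hm]; simp [lamMax]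
  | p + 2, hp => by
    obtain ⟨n, rfl⟩ := Nat.exists_eq_add_of_le hp
    have hcos : Real.cos (Real.pi / (p + 2 + n : ℕ) / 2 * (n + 1)) =
        Real.sin (Real.pi * (p + 1) / (2 * (p + 2 + n : ℕ))) := by
      rw [← Real.cos_pi_div_two_sub]
      congr 1
      field_simp
      push_cast
      ring
    have hsin : Real.sin (Real.pi * (p + 1) / (2 * (p + 2 + n : ℕ))) ≠ 0 := by
      have hfactor := cosProd_factor_pos (m := p + 2 + n) (n := n + 2) (Nat.lt_succ_self (n + 1))
        (by omega)
      rw [show 2 * ((n + 1 : ℕ) : ℝ) - ((n + 2 : ℕ) - 1) = n + 1 by push_cast; ring, hcos]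
        at hfactor
      exact (pos_of_mul_pos_right hfactor zero_le_two).ne'
    rw [lamMax_add_two, lamMax_eq_cosProd hm p (by omega), Nat.add_sub_cancel_left,
      show p + 2 + n - p = n + 2 by omega, cosProd_add_two, hcos, mul_pow,
      show (2 : ℝ) ^ 2 = 4 by norm_num]
    exact mul_div_cancel_right₀ _ (mul_ne_zero four_ne_zero (pow_ne_zero 2 hsin))

theorem lamMax_pos {m p : ℕ} (hm : m ≠ 0) (hp : p ≤ m) : 0 < lamMax m p := by
  rw [lamMax_eq_cosProd hm p hp]
  exact cosProd_pos (Nat.sub_le m p)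

/-! ### Nonnegative matrices -/

section NonnegMatrix

open Matrix

variable {n : Type*} [Fintype n] {M : Matrix n n ℝ} {u v w : n → ℝ} {x : ℝ}

theorem mulVec_le_mulVec_of_nonneg (hM : ∀ i j, 0 ≤ M i j) (h : u ≤ w) : M *ᵥ u ≤ M *ᵥ w :=
  fun i => dotProduct_le_dotProduct_of_nonneg_left h (hM i)

theorem le_mulVec_of_one_le_diag (hM : ∀ i j, 0 ≤ M i j) (hdiag : ∀ i, 1 ≤ M i i) (hu : 0 ≤ u) :
    u ≤ M *ᵥ u := fun i =>
  (le_mul_of_one_le_left (hu i) (hdiag i)).trans <|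
    Finset.single_le_sum (f := fun j => M i j * u j) (fun j _ => mul_nonneg (hM i j) (hu j))
      (Finset.mem_univ i)

theorem one_le_of_mulVec_eq_smul (hM : ∀ i j, 0 ≤ M i j) (hdiag : ∀ i, 1 ≤ M i i) (hv : 0 ≤ v)
    {i : n} (hi : 0 < v i) (hMv : M *ᵥ v = x • v) : 1 ≤ x := by
  have hle := le_mulVec_of_one_le_diag hM hdiag hv i
  rw [hMv, Pi.smul_apply, smul_eq_mul] at hle
  exact le_of_mul_le_mul_right (by rwa [one_mul]) hi

/-- Compare `|u|` with the multiple of `v` that touches it from above. -/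
theorem norm_eigenvalue_le_of_mulVec_le (hM : ∀ i j, 0 ≤ M i j) (hv : ∀ i, 0 < v i)
    (hMv : M *ᵥ v ≤ x • v) {μ : ℂ} {u : n → ℂ} (hu : u ≠ 0)
    (hMu : M.map (fun a : ℝ => (a : ℂ)) *ᵥ u = μ • u) : ‖μ‖ ≤ x := by
  obtain ⟨j, hj⟩ := Function.ne_iff.1 hu
  have : Nonempty n := ⟨j⟩
  obtain ⟨i, hi⟩ := Finite.exists_max fun i => ‖u i‖ / v i
  set c := ‖u i‖ / v i
  have hcpos : 0 < c := (div_pos (norm_pos_iff.2 hj) (hv j)).trans_le (hi j)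
  have htouch : ‖u i‖ = c * v i := (div_mul_cancel₀ _ (hv i).ne').symm
  have hle : ∀ j, ‖u j‖ ≤ c * v j := fun j => (div_le_iff₀ (hv j)).1 (hi j)
  have hpos : 0 < ‖u i‖ := htouch ▸ mul_pos hcpos (hv i)
  refine le_of_mul_le_mul_right ?_ hpos
  calc ‖μ‖ * ‖u i‖ = ‖∑ j, (M i j : ℂ) * u j‖ := by
        rw [← norm_mul]
        exact congrArg norm (congrFun hMu i).symm
    _ ≤ ∑ j, M i j * ‖u j‖ := (norm_sum_le _ _).trans_eq <| Finset.sum_congr rfl fun j _ => by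
        rw [norm_mul, Complex.norm_real, Real.norm_of_nonneg (hM i j)]
    _ ≤ (M *ᵥ c • v) i := dotProduct_le_dotProduct_of_nonneg_left hle (hM i)
    _ = c * (M *ᵥ v) i := by rw [mulVec_smul, Pi.smul_apply, smul_eq_mul]
    _ ≤ c * (x * v i) := mul_le_mul_of_nonneg_left (hMv i) hcpos.le
    _ = x * ‖u i‖ := by rw [htouch, mul_left_comm]

theorem isLargestEigenvalue_of_mulVec_eq_smul [DecidableEq n] [Nonempty n]
    (hM : ∀ i j, 0 ≤ M i j) (hv : ∀ i, 0 < v i) (hMv : M *ᵥ v = x • v) :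
    IsLargestEigenvalue M x := by
  have hv0 : v ≠ 0 := Function.ne_iff.2 ⟨Classical.arbitrary n, (hv _).ne'⟩
  refine ⟨Module.End.hasEigenvalue_of_hasEigenvector (x := v)
    (Module.End.hasEigenvector_iff.2 ⟨Module.End.mem_eigenspace_iff.2 hMv, hv0⟩), fun μ hμ => ?_⟩
  obtain ⟨u, hu, hu0⟩ := hμ.exists_hasEigenvector
  exact norm_eigenvalue_le_of_mulVec_le hM hv hMv.le hu0 (Module.End.mem_eigenspace_iff.1 hu)

section Powers

variable [DecidableEq n]

theorem pow_mulVec_eq_pow_smul (hMv : M *ᵥ v = x • v) (k : ℕ) : M ^ k *ᵥ v = x ^ k • v := by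
  induction k with
  | zero => simp
  | succ k ih => rw [pow_succ', ← mulVec_mulVec, ih, mulVec_smul, hMv, smul_smul, pow_succ]

theorem pow_mulVec_le_pow_mulVec (hM : ∀ i j, 0 ≤ M i j) (h : u ≤ w) (k : ℕ) :
    M ^ k *ᵥ u ≤ M ^ k *ᵥ w := by
  induction k with
  | zero => simpa using h
  | succ k ih =>
    rw [pow_succ', ← mulVec_mulVec, ← mulVec_mulVec]
    exact mulVec_le_mulVec_of_nonneg hM ih

theorem dotProduct_pow_mulVec_le (hM : ∀ i j, 0 ≤ M i j) (hMv : M *ᵥ v = x • v) (hu : 0 ≤ u)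
    {C : ℝ} (huv : u ≤ C • v) (k : ℕ) : u ⬝ᵥ M ^ k *ᵥ u ≤ C * x ^ k * (u ⬝ᵥ v) := by
  refine (dotProduct_le_dotProduct_of_nonneg_left (pow_mulVec_le_pow_mulVec hM huv k) hu).trans_eq
    ?_
  rw [mulVec_smul, pow_mulVec_eq_pow_smul hMv, smul_smul, dotProduct_smul, smul_eq_mul]

theorem vecMul_pow_eq_pow_mulVec {R : Type*} [CommSemiring R] {M : Matrix n n R} {σ : n ≃ n}
    (hσ : ∀ i j, M (σ i) j = M j i) {w : n → R} (hw : ∀ i, w (σ i) = w i) (k : ℕ) :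
    w ᵥ* M ^ k = M ^ k *ᵥ w := by
  induction k generalizing w with
  | zero => simp
  | succ k ih =>
    have hvecMul : w ᵥ* M = M *ᵥ w := by
      ext j
      simp only [vecMul, mulVec, dotProduct]
      rw [← σ.sum_comp]
      simp only [hσ, hw, mul_comm]
    have hinvariant : ∀ i, (M *ᵥ w) (σ i) = (M *ᵥ w) i := fun i => by
      simp only [mulVec, dotProduct]
      rw [← σ.sum_comp]
      simp only [hσ, hw]
    rw [pow_succ', ← vecMul_vecMul, hvecMul, ih hinvariant, mulVec_mulVec,
      (Commute.pow_self M k).eq]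

/-- Since `M` is symmetric up to the permutation `σ`, the number `u ⬝ᵥ M ^ (2 * i) *ᵥ u` is a
squared norm, which Cauchy–Schwarz compares with the component along `v`. An odd exponent is reduced
to an even one by dropping one factor of `M`. -/
theorem sq_dotProduct_mul_pow_le (hM : ∀ i j, 0 ≤ M i j) (hdiag : ∀ i, 1 ≤ M i i) {σ : n ≃ n}
    (hσ : ∀ i j, M (σ i) j = M j i) (hv : ∀ i, v (σ i) = v i) (hMv : M *ᵥ v = x • v)
    (hx : 1 ≤ x) (hu : ∀ i, u (σ i) = u i) (hu0 : 0 ≤ u) (k : ℕ) :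
    (v ⬝ᵥ u) ^ 2 * x ^ k ≤ (v ⬝ᵥ v) * (u ⬝ᵥ M ^ (k + 1) *ᵥ u) := by
  have hvv : 0 ≤ v ⬝ᵥ v := Finset.sum_nonneg fun i _ => mul_self_nonneg (v i)
  have even_pow (i : ℕ) : (v ⬝ᵥ u) ^ 2 * x ^ (2 * i) ≤ (v ⬝ᵥ v) * (u ⬝ᵥ M ^ (2 * i) *ᵥ u) := by
    calc (v ⬝ᵥ u) ^ 2 * x ^ (2 * i) = (v ⬝ᵥ M ^ i *ᵥ u) ^ 2 := by
          rw [dotProduct_mulVec, vecMul_pow_eq_pow_mulVec hσ hv, pow_mulVec_eq_pow_smul hMv,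
            smul_dotProduct, smul_eq_mul]
          ring
      _ ≤ (v ⬝ᵥ v) * (M ^ i *ᵥ u ⬝ᵥ M ^ i *ᵥ u) := by
          simpa only [dotProduct, sq] using
            Finset.sum_mul_sq_le_sq_mul_sq Finset.univ v (M ^ i *ᵥ u)
      _ = (v ⬝ᵥ v) * (u ⬝ᵥ M ^ (2 * i) *ᵥ u) := by
          rw [two_mul, pow_add, ← mulVec_mulVec, dotProduct_mulVec u,
            vecMul_pow_eq_pow_mulVec hσ hu]
  have odd_pow (i : ℕ) : u ⬝ᵥ M ^ i *ᵥ u ≤ u ⬝ᵥ M ^ (i + 1) *ᵥ u := by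
    refine dotProduct_le_dotProduct_of_nonneg_left ?_ hu0
    rw [pow_succ, ← mulVec_mulVec]
    exact pow_mulVec_le_pow_mulVec hM (le_mulVec_of_one_le_diag hM hdiag hu0) i
  obtain ⟨i, hi | hi⟩ := Nat.even_or_odd' (k + 1)
  · rw [hi]
    refine le_trans ?_ (even_pow i)
    exact mul_le_mul_of_nonneg_left (pow_le_pow_right₀ hx (by omega)) (sq_nonneg _)
  · obtain rfl : k = 2 * i := by omega
    exact (even_pow i).trans (mul_le_mul_of_nonneg_left (odd_pow _) hvv)

end Powers

end NonnegMatrix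

/-! ### The Perron vectors of the transfer matrix -/

/-- The eigenvector of the transfer matrix for `lamMax m p`, supported on and positive on the
sector `p`. -/
noncomputable def sectorVector (m p : ℕ) (S : Finset (Fin m)) : ℝ :=
  if S.card = p then rootVandermonde Sᶜ else 0

theorem sectorVector_pos {m : ℕ} (S : Finset (Fin m)) : 0 < sectorVector m S.card S := by
  rw [sectorVector, if_pos rfl]
  exact rootVandermonde_pos _

theorem sectorVector_nonneg (m p : ℕ) : 0 ≤ sectorVector m p :=
  fun _ => ite_nonneg (rootVandermonde_pos _).le le_rfl

theorem sectorVector_rotateSet {m p : ℕ} (S : Finset (Fin m)) :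
    sectorVector m p (rotateSet S) = sectorVector m p S := by
  have hcompl : (rotateSet S)ᶜ = Sᶜ.map (finRotate m).toEmbedding := by
    ext l
    simp [mem_rotateSet, Finset.mem_map_equiv]
  rw [sectorVector, card_rotateSet, hcompl, rootVandermonde_map_finRotate, sectorVector]

theorem exists_card_eq {m p : ℕ} (hp : p ≤ m) : ∃ S : Finset (Fin m), S.card = p := by
  simpa using Finset.exists_subset_card_eq (s := (Finset.univ : Finset (Fin m))) (by simpa using hp)

section PerronVector

open Matrix

variable {m : ℕ}

theorem transferMatrix_mulVec_sectorVector (hm : 2 ≤ m) {p : ℕ} (hp : p ≤ m) :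
    transferMatrix m *ᵥ sectorVector m p = lamMax m p • sectorVector m p := by
  ext S
  by_cases hS : S.card = p
  · rw [lamMax_eq_cosProd (by omega) p hp, Pi.smul_apply, smul_eq_mul, sectorVector, if_pos hS,
      ← hS, ← transferMatrix_mulVec_rootVandermonde hm, mulVec, mulVec, dotProduct, dotProduct]
    refine Finset.sum_congr rfl fun T _ => ?_
    by_cases hT : T.card = S.card
    · rw [sectorVector, if_pos hT]
    · rw [transferMatrix_eq_zero hm (Ne.symm hT), zero_mul, zero_mul]
  · rw [Pi.smul_apply, sectorVector, if_neg hS, smul_zero, mulVec, dotProduct]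
    refine Finset.sum_eq_zero fun T _ => ?_
    by_cases hT : T.card = p
    · rw [transferMatrix_eq_zero hm fun h => hS (h.trans hT), zero_mul]
    · rw [sectorVector, if_neg hT, mul_zero]

theorem sectorBlock_mulVec_sectorVector (p : ℕ) (S : {S : Finset (Fin m) // S.card = p}) :
    (sectorBlock m p *ᵥ fun T => sectorVector m p T.1) S =
      (transferMatrix m *ᵥ sectorVector m p) S.1 := by
  refine (Finset.sum_subtype (p := fun T : Finset (Fin m) => T.card = p)
    (Finset.univ.filter fun T => T.card = p) (by simp)
    fun T => transferMatrix m S.1 T * sectorVector m p T).symm.trans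
      (Finset.sum_filter_of_ne fun T _ hne => ?_)
  by_contra hT
  rw [sectorVector, if_neg hT, mul_zero] at hne
  exact hne rfl

theorem isLargestEigenvalue_sectorBlock (hm : 2 ≤ m) {p : ℕ} (hp : p ≤ m) :
    IsLargestEigenvalue (sectorBlock m p) (lamMax m p) := by
  obtain ⟨S, hS⟩ := exists_card_eq hp
  have : Nonempty {S : Finset (Fin m) // S.card = p} := ⟨⟨S, hS⟩⟩
  refine isLargestEigenvalue_of_mulVec_eq_smul (v := fun T => sectorVector m p T.1)
    (fun S T => transferMatrix_nonneg m S.1 T.1) ?_ ?_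
  · rintro ⟨T, rfl⟩
    exact sectorVector_pos T
  · ext T
    rw [sectorBlock_mulVec_sectorVector, transferMatrix_mulVec_sectorVector hm hp]
    rfl

theorem one_le_lamMax (hm : 2 ≤ m) {p : ℕ} (hp : p ≤ m) : 1 ≤ lamMax m p := by
  obtain ⟨S, rfl⟩ := exists_card_eq hp
  exact one_le_of_mulVec_eq_smul (transferMatrix_nonneg m) (one_le_transferMatrix_self hm)
    (sectorVector_nonneg m S.card) (sectorVector_pos S) (transferMatrix_mulVec_sectorVector hm hp)

theorem exists_sectorGon_le_smul_sectorVector (m p : ℕ) :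
    ∃ C : ℝ, sectorGon m p ≤ C • sectorVector m p := by
  refine ⟨∑ T, sectorGon m p T / sectorVector m p T, fun S => ?_⟩
  by_cases hS : S.card = p
  · have hpos : 0 < sectorVector m p S := hS ▸ sectorVector_pos S
    rw [Pi.smul_apply, smul_eq_mul, ← div_le_iff₀ hpos]
    exact Finset.single_le_sum (f := fun T => sectorGon m p T / sectorVector m p T)
      (fun T _ => div_nonneg (sectorGon_nonneg T) (sectorVector_nonneg m p T))
      (Finset.mem_univ S)
  · simp [sectorGon, sectorVector, hS]

theorem exists_sectorCount_le (hm : 3 ≤ m) {p : ℕ} (hp : p ≤ m) :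
    ∃ C : ℝ, ∀ k, (sectorCount m k p : ℝ) ≤ C * lamMax m p ^ k := by
  obtain ⟨C, hC⟩ := exists_sectorGon_le_smul_sectorVector m p
  refine ⟨C * lamMax m p * (sectorGon m p ⬝ᵥ sectorVector m p), fun k => ?_⟩
  rw [sectorCount_eq hm]
  refine (dotProduct_pow_mulVec_le (transferMatrix_nonneg m)
    (transferMatrix_mulVec_sectorVector (by omega) hp) sectorGon_nonneg hC _).trans_eq ?_
  ring

theorem exists_le_sectorCount (hm : 3 ≤ m) {q : ℕ} (hq : 2 * q ≤ m) :
    ∃ c : ℝ, 0 < c ∧ ∀ k, c * lamMax m (m - 2 * q) ^ k ≤ sectorCount m k (m - 2 * q) := by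
  obtain ⟨S, hS, hpos⟩ := exists_gonCount_pos hq
  set p := m - 2 * q
  have hp : p ≤ m := Nat.sub_le _ _
  have hvS : 0 < sectorVector m p S := hS ▸ sectorVector_pos S
  have hvb : 0 < sectorVector m p ⬝ᵥ sectorGon m p :=
    Finset.sum_pos' (fun T _ => mul_nonneg (sectorVector_nonneg m p T) (sectorGon_nonneg T))
      ⟨S, Finset.mem_univ S, mul_pos hvS (by rwa [sectorGon, if_pos hS])⟩
  have hvv : 0 < sectorVector m p ⬝ᵥ sectorVector m p :=
    Finset.sum_pos' (fun T _ => mul_self_nonneg _) ⟨S, Finset.mem_univ S, mul_pos hvS hvS⟩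
  refine ⟨(sectorVector m p ⬝ᵥ sectorGon m p) ^ 2 / (sectorVector m p ⬝ᵥ sectorVector m p),
    div_pos (pow_pos hvb 2) hvv, fun k => ?_⟩
  rw [sectorCount_eq hm, div_mul_eq_mul_div, div_le_iff₀' hvv]
  exact sq_dotProduct_mul_pow_le (transferMatrix_nonneg m)
    (one_le_transferMatrix_self (by omega)) (transferMatrix_rotateSet (by omega))
    sectorVector_rotateSet (transferMatrix_mulVec_sectorVector (by omega) hp)
    (one_le_lamMax (by omega) hp) sectorGon_rotateSet sectorGon_nonneg k

end PerronVector

/-! ### The dominant sector -/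

theorem strictMonoOn_cosProd_two_mul (m : ℕ) :
    StrictMonoOn (fun q => cosProd (2 * q) (Real.pi / m)) (Set.Iic ((m + 1) / 3)) := by
  refine strictMonoOn_of_lt_succ Set.ordConnected_Iic fun q _ _ hq => ?_
  rw [Nat.succ_eq_succ, Set.mem_Iic] at hq
  have hqm : 3 * (2 * (q : ℝ) + 1) < 2 * m := by
    exact_mod_cast (by omega : 3 * (2 * q + 1) < 2 * m)
  have hm : (0 : ℝ) < m := by linarith [(q.cast_nonneg : (0 : ℝ) ≤ q)]
  have hangle : Real.pi / m / 2 * ((2 * q : ℕ) + 1) < Real.pi / 3 := by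
    push_cast
    rw [div_div, div_mul_eq_mul_div, div_lt_div_iff₀ (by positivity) three_pos]
    nlinarith [Real.pi_pos]
  have hcos := Real.cos_lt_cos_of_nonneg_of_le_pi_div_two (by positivity)
    (by linarith [Real.pi_pos]) hangle
  rw [Real.cos_pi_div_three] at hcos
  rw [Nat.succ_eq_succ, Nat.mul_succ, cosProd_add_two]
  exact lt_mul_of_one_lt_right (cosProd_pos (by omega))
    (one_lt_pow₀ (by linarith) two_ne_zero)

theorem strictAntiOn_cosProd_two_mul (m : ℕ) :
    StrictAntiOn (fun q => cosProd (2 * q) (Real.pi / m)) (Set.Icc ((m + 1) / 3) (m / 2)) := by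
  refine strictAntiOn_of_succ_lt Set.ordConnected_Icc fun q _ hq hq' => ?_
  rw [Nat.succ_eq_succ, Set.mem_Icc] at hq'
  have hqm : 2 * (m : ℝ) < 3 * (2 * q + 1) := by
    exact_mod_cast (by have := hq.1; omega : 2 * m < 3 * (2 * q + 1))
  have hqm' : 2 * (q : ℝ) + 1 ≤ m := by exact_mod_cast (by omega : 2 * q + 1 ≤ m)
  have hm : (0 : ℝ) < m := by linarith [(q.cast_nonneg : (0 : ℝ) ≤ q)]
  have hangle : Real.pi / 3 < Real.pi / m / 2 * ((2 * q : ℕ) + 1) := by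
    push_cast
    rw [div_div, div_mul_eq_mul_div, div_lt_div_iff₀ three_pos (by positivity)]
    nlinarith [Real.pi_pos]
  have hangle' : Real.pi / m / 2 * ((2 * q : ℕ) + 1) ≤ Real.pi / 2 := by
    push_cast
    rw [div_div, div_mul_eq_mul_div, div_le_div_iff₀ (by positivity) two_pos]
    nlinarith [Real.pi_pos]
  have hcos := Real.cos_lt_cos_of_nonneg_of_le_pi_div_two (by positivity) hangle' hangle
  rw [Real.cos_pi_div_three] at hcos
  have hcos' := Real.cos_nonneg_of_neg_pi_div_two_le_of_le (by linarith [Real.pi_pos]) hangle'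
  rw [Nat.succ_eq_succ, Nat.mul_succ, cosProd_add_two]
  exact mul_lt_of_lt_one_right (cosProd_pos (by omega))
    (pow_lt_one₀ (by linarith) (by linarith) two_ne_zero)

theorem lamMax_lt_lamMax_dominantSector {m p : ℕ} (hp : p ≤ m) (heven : Even (m - p))
    (hne : p ≠ dominantSector m) : lamMax m p < lamMax m (dominantSector m) := by
  unfold dominantSector at *
  obtain ⟨q, hq⟩ := heven
  have hq_ne : q ≠ (m + 1) / 3 := by omega
  have hm : m ≠ 0 := by omega
  rw [lamMax_eq_cosProd hm _ hp, lamMax_eq_cosProd hm _ (Nat.sub_le _ _), hq,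
    Nat.sub_sub_self (by omega), ← two_mul]
  rcases lt_or_gt_of_ne hq_ne with hlt | hgt
  · exact strictMonoOn_cosProd_two_mul m hlt.le Set.self_mem_Iic hlt
  · exact strictAntiOn_cosProd_two_mul m ⟨le_rfl, by omega⟩ ⟨hgt.le, by omega⟩ hgt

theorem exists_sum_le_mul_pow_of_lt {ι : Type*} {s : Finset ι} {f : ι → ℕ → ℝ} {x : ℝ} (hx : 0 < x)
    (hf : ∀ i ∈ s, ∃ C y : ℝ, 0 ≤ y ∧ y < x ∧ ∀ k, f i k ≤ C * y ^ k) :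
    ∃ C y : ℝ, 0 < C ∧ 0 < y ∧ y < x ∧ ∀ k, ∑ i ∈ s, f i k ≤ C * y ^ k := by
  induction s using Finset.cons_induction with
  | empty =>
    exact ⟨1, x / 2, one_pos, half_pos hx, half_lt_self hx, fun k => by
      rw [Finset.sum_empty]; positivity⟩
  | cons i s his ih =>
    rw [Finset.forall_mem_cons] at hf
    obtain ⟨C, y, hC, hy, hyx, hsum⟩ := ih hf.2
    obtain ⟨D, z, hz, hzx, hterm⟩ := hf.1
    refine ⟨|D| + C, max z y, by positivity, lt_max_of_lt_right hy, max_lt hzx hyx, fun k => ?_⟩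
    rw [Finset.sum_cons, add_mul]
    refine add_le_add ((hterm k).trans ?_) ((hsum k).trans ?_)
    · gcongr
      · exact le_abs_self D
      · exact le_max_left z y
    · gcongr
      exact le_max_right z y

theorem tendsto_const_mul_pow_rpow_one_div {c x : ℝ} (hc : 0 < c) (hx : 0 ≤ x) :
    Tendsto (fun k : ℕ => (c * x ^ k) ^ (1 / (k : ℝ))) atTop (𝓝 x) := by
  have hroot : Tendsto (fun k : ℕ => c ^ (1 / (k : ℝ)) * x) atTop (𝓝 (c ^ (0 : ℝ) * x)) :=
    (tendsto_const_nhds.rpow tendsto_one_div_atTop_nhds_zero_nat (Or.inl hc.ne')).mul_const x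
  rw [Real.rpow_zero, one_mul] at hroot
  refine hroot.congr' ?_
  filter_upwards [eventually_ne_atTop 0] with k hk
  rw [Real.mul_rpow hc.le (pow_nonneg hx k), one_div, Real.pow_rpow_inv_natCast hx hk]

section Barrel

variable {m : ℕ}

theorem dominantSector_le (m : ℕ) : dominantSector m ≤ m :=
  Nat.sub_le _ _

theorem exists_card_ne_dominantSector_le (hm : 3 ≤ m) :
    ∃ C r : ℝ, 0 < C ∧ 0 < r ∧ r < 1 ∧ ∀ k : ℕ,
      (Nat.card {M : PerfectMatching (barrelFullerene m k) //
          ∃ j : Fin (k + 2), horizontalCount M j ≠ dominantSector m} : ℝ)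
        ≤ C * (r ^ k * lamMax m (dominantSector m) ^ k) := by
  have hlam := lamMax_pos (by omega : m ≠ 0) (dominantSector_le m)
  obtain ⟨C, y, hC, hy, hylam, hsum⟩ := exists_sum_le_mul_pow_of_lt
    (s := (Finset.range (m + 1)).erase (dominantSector m))
    (f := fun p k => (sectorCount m k p : ℝ)) hlam fun p hp => by
      obtain ⟨hne, hp⟩ := Finset.mem_erase.1 hp
      have hpm : p ≤ m := Finset.mem_range_succ_iff.1 hp
      by_cases heven : Even (m - p)
      · obtain ⟨D, hD⟩ := exists_sectorCount_le hm hpm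
        exact ⟨D, lamMax m p, (lamMax_pos (by omega) hpm).le,
          lamMax_lt_lamMax_dominantSector hpm heven hne, hD⟩
      · exact ⟨0, 0, le_rfl, hlam, fun k => by simp [sectorCount_eq_zero hm k heven]⟩
  refine ⟨C, y / lamMax m (dominantSector m), hC, div_pos hy hlam, (div_lt_one hlam).2 hylam,
    fun k => ?_⟩
  rw [card_horizontalCount_ne_eq_sum hm, Nat.cast_sum, ← mul_pow, div_mul_cancel₀ _ hlam.ne']
  exact hsum k

theorem exists_le_numPerfectMatchings (hm : 3 ≤ m) :
    ∃ c : ℝ, 0 < c ∧ ∀ k,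
      c * lamMax m (dominantSector m) ^ k ≤ numPerfectMatchings (barrelFullerene m k) := by
  obtain ⟨c, hc, hle⟩ := exists_le_sectorCount hm (q := (m + 1) / 3) (by omega)
  refine ⟨c, hc, fun k => (hle k).trans ?_⟩
  rw [numPerfectMatchings_eq_sectorCount_add m k (dominantSector m), Nat.cast_le]
  exact Nat.le_add_right _ _

theorem exists_numPerfectMatchings_le (hm : 3 ≤ m) :
    ∃ C : ℝ, 0 < C ∧ ∀ k,
      numPerfectMatchings (barrelFullerene m k) ≤ C * lamMax m (dominantSector m) ^ k := by
  have hlam := lamMax_pos (by omega : m ≠ 0) (dominantSector_le m)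
  obtain ⟨C, r, hC, hr, hr1, hne⟩ := exists_card_ne_dominantSector_le hm
  obtain ⟨D, hD⟩ := exists_sectorCount_le hm (dominantSector_le m)
  refine ⟨|D| + C, by positivity, fun k => ?_⟩
  rw [numPerfectMatchings_eq_sectorCount_add m k (dominantSector m), Nat.cast_add, add_mul]
  refine add_le_add ((hD k).trans ?_) ((hne k).trans ?_)
  · gcongr
    exact le_abs_self D
  · gcongr
    exact mul_le_of_le_one_left (by positivity) (pow_le_one₀ hr.le hr1.le)

theorem tendsto_numPerfectMatchings_rpow_one_div (hm : 3 ≤ m) :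
    Tendsto (fun k : ℕ => (numPerfectMatchings (barrelFullerene m k) : ℝ) ^ (1 / (k : ℝ)))
      atTop (𝓝 (lamMax m (dominantSector m))) := by
  have hlam := lamMax_pos (by omega : m ≠ 0) (dominantSector_le m)
  obtain ⟨c, hc, hlower⟩ := exists_le_numPerfectMatchings hm
  obtain ⟨C, hC, hupper⟩ := exists_numPerfectMatchings_le hm
  exact tendsto_of_tendsto_of_tendsto_of_le_of_le
    (tendsto_const_mul_pow_rpow_one_div hc hlam.le) (tendsto_const_mul_pow_rpow_one_div hC hlam.le)
    (fun k => Real.rpow_le_rpow (by positivity) (hlower k) (by positivity))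
    (fun k => Real.rpow_le_rpow (by positivity) (hupper k) (by positivity))

theorem matchingProb_nonneg (m k : ℕ) (E : Set (PerfectMatching (barrelFullerene m k))) :
    0 ≤ matchingProb m k E :=
  div_nonneg (Nat.cast_nonneg _) (Nat.cast_nonneg _)

theorem matchingProb_mono {k : ℕ} {E E' : Set (PerfectMatching (barrelFullerene m k))}
    (h : E ⊆ E') : matchingProb m k E ≤ matchingProb m k E' :=
  div_le_div_of_nonneg_right (Nat.cast_le.2 (Nat.card_mono E'.toFinite h)) (Nat.cast_nonneg _)

theorem tendsto_matchingProb_ne_dominantSector (hm : 3 ≤ m) :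
    Tendsto (fun k : ℕ => matchingProb m k
        {M | ∃ j : Fin (k + 2), horizontalCount M j ≠ dominantSector m}) atTop (𝓝 0) := by
  have hlam := lamMax_pos (by omega : m ≠ 0) (dominantSector_le m)
  obtain ⟨C, r, hC, hr, hr1, hne⟩ := exists_card_ne_dominantSector_le hm
  obtain ⟨c, hc, hlower⟩ := exists_le_numPerfectMatchings hm
  have hlim : Tendsto (fun k : ℕ => C / c * r ^ k) atTop (𝓝 0) := by
    simpa only [mul_zero] using
      (tendsto_pow_atTop_nhds_zero_of_lt_one hr.le hr1).const_mul (C / c)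
  refine squeeze_zero (fun k => matchingProb_nonneg m k _) (fun k => ?_) hlim
  have hpos : 0 < c * lamMax m (dominantSector m) ^ k := by positivity
  calc matchingProb m k {M | ∃ j : Fin (k + 2), horizontalCount M j ≠ dominantSector m}
      ≤ C * (r ^ k * lamMax m (dominantSector m) ^ k) /
          (c * lamMax m (dominantSector m) ^ k) :=
        div_le_div₀ (by positivity) (hne k) hpos (hlower k)
    _ = C / c * r ^ k := by field_simp

end Barrel

theorem mainTheorem2 (m : ℕ) (hm : 3 ≤ m) :
    -- the largest eigenvalue of the transfer matrix in each sector is given explicitly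
    (∀ p : ℕ, p ≤ m → IsLargestEigenvalue (sectorBlock m p) (lamMax m p)) ∧
    -- the growth constant exists and equals the largest eigenvalue in the sector `p₀`
    Tendsto (fun k : ℕ =>
        (numPerfectMatchings (barrelFullerene m k) : ℝ) ^ (1 / (k : ℝ)))
      atTop (𝓝 (lamMax m (dominantSector m))) ∧
    -- convergence in probability to `p₀` of the number of horizontal edges, uniformly on all slices
    (∀ ε : ℝ, 0 < ε →
      Tendsto (fun k : ℕ => matchingProb m k
          {M | ∃ j : Fin (k + 2), ε ≤ |(horizontalCount M j : ℝ) - (dominantSector m : ℝ)|})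
        atTop (𝓝 0)) ∧
    -- the contribution of the other sectors is exponentially smaller
    (∃ C r : ℝ, 0 < C ∧ 0 < r ∧ r < 1 ∧ ∀ k : ℕ,
      (Nat.card {M : PerfectMatching (barrelFullerene m k) //
          ∃ j : Fin (k + 2), horizontalCount M j ≠ dominantSector m} : ℝ)
        ≤ C * (r ^ k * lamMax m (dominantSector m) ^ k)) := by
  refine ⟨fun p hp => isLargestEigenvalue_sectorBlock (by omega) hp,
    tendsto_numPerfectMatchings_rpow_one_div hm, fun ε hε => ?_,
    exists_card_ne_dominantSector_le hm⟩
  refine squeeze_zero (fun k => matchingProb_nonneg m k _) (fun k => matchingProb_mono ?_)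
    (tendsto_matchingProb_ne_dominantSector hm)
  rintro M ⟨j, hj⟩
  refine ⟨j, fun heq => ?_⟩
  rw [heq, sub_self, abs_zero] at hj
  exact hj.not_gt hε
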